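/- Let $\mathbf k$ be a field of characteristic zero. A $\mathbf k[\partial]$-module is a $\mathbf k$-vector space with an endomorphism $\partial$; $V[\lambda]$ denotes polynomials with coefficients in $V$, and tensor products are over $\mathbf k$. For $\mathbf k[\partial]$-modules $U,V$, $\mathrm{Chom}(U,V)$ is the space of $\mathbf k$-linear maps $a_\lambda:U\to V[\lambda]$ with $a_\lambda(\partial u)=(\lambda+\partial)a_\lambda u$, a $\mathbf k[\partial]$-module via $(\partial a)_\lambda u=-\lambda a_\lambda u$; $\mathrm{Cend}(V)=\mathrm{Chom}(V,V)$ and $U^{*c}=\mathrm{Chom}(U,\mathbf k)$ with $\partial=0$ on $\mathbf k$; write $\langle f,u\rangle_\lambda=f_\lambda u$. When $-\lambda-\partial$ or $\lambda+\partial$ is substituted for the variable of a polynomial with coefficients in a module, $\partial$ acts on the coefficients. A Leibniz conformal algebra is a $\mathbf k[\partial]$-module $Q$ with a $\mathbf k$-bilinear map $[\cdot_\lambda\cdot]:Q\times Q\to Q[\lambda]$ such that $[\partial a_\lambda b]=-\lambda[a_\lambda b]$, $[a_\lambda\partial b]=(\lambda+\partial)[a_\lambda b]$ and $[a_\lambda[b_\mu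 c]]=[[a_\lambda b]_{\lambda+\mu}c]+[b_\mu[a_\lambda c]]$. A representation of $Q$ is a $\mathbf k[\partial]$-module $M$ with $\mathbf k[\partial]$-module homomorphisms $l,r:Q\to\mathrm{Cend}(M)$ such that, for all $a,b\in Q$ and $v\in M$, $$l(a)_\lambda(l(b)_\mu v)=l([a_\lambda b])_{\lambda+\mu}v+l(b)_\mu(l(a)_\lambda v),$$ $$l(a)_\lambda(r(b)_{-\mu-\partial}v)=r(b)_{-\lambda-\mu-\partial}(l(a)_\lambda v)+r([a_\lambda b])_{-\mu-\partial}v,$$ $$r(b)_{-\lambda-\mu-\partial}(r(a)_{-\mu-\partial}v)=-r(b)_{-\lambda-\mu-\partial}(l(a)_\lambda v).$$ The semidirect product $Q\ltimes_{l,r}M$ is the Leibniz conformal algebra $Q\oplus M$ with $$[(a+x)_\lambda(b+y)]=[a_\lambda b]+l(a)_\lambda y+r(b)_{-\lambda-\partial}x.$$ If $M$ is finitely generated over $\mathbf k[\partial]$, the dual representation is $(M^{*c},l^*,-l^*-r^*)$, where $\langle l^*(a)_\lambda f,v\rangle_\mu=-\langle f,l(a)_\lambda v\rangle_{\mu-\lambda}$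 and $\langle r^*(a)_\lambda f,v\rangle_\mu=-\langle f,r(a)_\lambda v\rangle_{\mu-\lambda}$. For a Leibniz conformal algebra $P$ and $r=\sum_i a_i\otimes b_i\in P\otimes P$, put $$[[r,r]]=\sum_{i,j}\Big([{a_i}_\mu a_j]\otimes b_i\otimes b_j\big|_{\mu=\partial_2}+a_i\otimes a_j\otimes[{b_j}_\mu b_i]\big|_{\mu=\partial_2}-a_i\otimes[{b_i}_\mu a_j]\otimes b_j\big|_{\mu=\partial_1}-a_i\otimes[{a_j}_\mu b_i]\otimes b_j\big|_{\mu=-\partial_1-\partial_2}\Big),$$ where $\partial_i$ is $\partial$ acting on the $i$-th factor of $P^{\otimes 3}$. Then $r$ is a solution of the classical Leibniz conformal Yang–Baxter equation (CLCYBE) in $P$ if $[[r,r]]\in(\partial_1+\partial_2+\partial_3)(P\otimes P\otimes P)$, and $r$ is symmetric if $\tau r=r$, where $\tau(a\otimes b)=b\otimes a$. A $\mathbf k[\partial]$-module homomorphism $S:M\to Q$ is an $\mathcal O$-operator on $Q$ associated to $(M,l,r)$ if $[S(x)_\lambda S(y)]=S\big(l(S(x))_\lambda y+r(S(y))_{-\lambda-\partial}x\big)$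 for all $x,y\in M$. **Theorem.** Let $Q$ be a Leibniz conformal algebra and $(M,l,r)$ a representation of $Q$, with $Q$ and $M$ both finitely generated and free over $\mathbf k[\partial]$. Let $\eta:\mathrm{Chom}(M,Q)\to M^{*c}\otimes Q$ be the inverse of the isomorphism $\varphi:M^{*c}\otimes Q\to\mathrm{Chom}(M,Q)$, $\varphi(f\otimes a)_\lambda v=\langle f,v\rangle_{\lambda+\partial}\,a$ (here $\partial$ acts on $a\in Q$). Let $T\in\mathrm{Chom}(M,Q)$ and regard $\eta(T)\in M^{*c}\otimes Q$ as an element of $P\otimes P$, where $P=Q\ltimes_{l^*,-l^*-r^*}M^{*c}$. Then $\eta(T)+\tau\eta(T)$ is a symmetric solution of the CLCYBE in $P$ if and only if $T_0=T_\lambda|_{\lambda=0}:M\to Q$ is an $\mathcal O$-operator on $Q$ associated to $(M,l,r)$. -/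

import Mathlib

open scoped Polynomial TensorProduct

namespace LeibnizConformal

set_option linter.unusedSectionVars false

noncomputable section

/-! ## Polynomials with coefficients in a module, and substitution -/

/-- The action of `∂` on a `k[∂]`-module, as a `k`-linear endomorphism. -/
def del (k : Type*) [Field k] (V : Type*) [AddCommGroup V] [Module k V] [Module k[X] V]
    [IsScalarTower k k[X] V] : Module.End k V :=
  Algebra.lsmul k k V (Polynomial.X : k[X])

/-- `V[λ]`: polynomials in one variable with coefficients in `V`; the value at `n` is the
coefficient of `λ ^ n`.  If `V` is a `k[∂]`-module, `∂` acts on `V[λ]` coefficientwise. -/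
abbrev VPoly (V : Type*) [AddCommGroup V] : Type _ := ℕ →₀ V

/-- `V[λ, μ] = V[λ][μ]`. -/
abbrev VPoly₂ (V : Type*) [AddCommGroup V] : Type _ := VPoly (VPoly V)

section Poly

variable (k : Type*) [Field k] {V W : Type*} [AddCommGroup V] [Module k V]
  [AddCommGroup W] [Module k W]

/-- Multiplication by the variable on `V[λ]`. -/
def lam (V : Type*) [AddCommGroup V] [Module k V] : Module.End k (VPoly V) :=
  Finsupp.lmapDomain V k Nat.succ

/-- The constants `V → V[λ]`. -/
def const (V : Type*) [AddCommGroup V] [Module k V] : V →ₗ[k] VPoly V :=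
  Finsupp.lsingle 0

/-- Multiplication by `λ` on `V[λ, μ]`. -/
def varL (V : Type*) [AddCommGroup V] [Module k V] : Module.End k (VPoly₂ V) :=
  Finsupp.mapRange.linearMap (lam k V)

/-- Multiplication by `μ` on `V[λ, μ]`. -/
def varM (V : Type*) [AddCommGroup V] [Module k V] : Module.End k (VPoly₂ V) :=
  lam k (VPoly V)

/-- The constants `V → V[λ, μ]`. -/
def const₂ (V : Type*) [AddCommGroup V] [Module k V] : V →ₗ[k] VPoly₂ V :=
  const k (VPoly V) ∘ₗ const k V

variable {k}

/-- Substitution of an operator `D` for the variable: `∑ λ ^ n v_n ↦ ∑ D ^ n (φ v_n)`. -/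
def subst (D : Module.End k W) (φ : V →ₗ[k] W) : VPoly V →ₗ[k] W :=
  Finsupp.lsum k fun n => (D ^ n) ∘ₗ φ

/-- `p(λ) ↦ p(-λ-∂)`, where `∂` acts on the coefficients of `p`. -/
def skew (k : Type*) [Field k] (V : Type*) [AddCommGroup V] [Module k V] [Module k[X] V]
    [IsScalarTower k k[X] V] : VPoly V →ₗ[k] VPoly V :=
  subst (-lam k V - del k (VPoly V)) (const k V)

end Poly

/-! ### Evaluation at scalars -/

section Eval

variable {k : Type*} [Field k] {V W : Type*} [AddCommGroup V] [Module k V]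
  [AddCommGroup W] [Module k W]

theorem lam_zero (p : VPoly V) : (lam k V p) 0 = 0 := by
  simp only [lam, Finsupp.lmapDomain_apply]
  exact Finsupp.mapDomain_of_notMem_range _ _ (by simp)

theorem lam_succ (p : VPoly V) (n : ℕ) : (lam k V p) (n + 1) = p n := by
  simp only [lam, Finsupp.lmapDomain_apply]
  exact Finsupp.mapDomain_apply Nat.succ_injective _ _

theorem del_coeff [Module k[X] V] [IsScalarTower k k[X] V] (p : VPoly V) (n : ℕ) :
    (del k (VPoly V) p) n = del k V (p n) := by
  simp [del]

theorem lam_single (n : ℕ) (v : V) :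
    lam k V (Finsupp.single n v) = Finsupp.single (n + 1) v := by
  simp [lam, Finsupp.mapDomain_single]

theorem subst_single (D : Module.End k W) (φ : V →ₗ[k] W) (n : ℕ) (v : V) :
    subst D φ (Finsupp.single n v) = (D ^ n) (φ v) := by
  simp [subst]

theorem subst_lam (D : Module.End k W) (φ : V →ₗ[k] W) (p : VPoly V) :
    subst D φ (lam k V p) = D (subst D φ p) := by
  induction p using Finsupp.induction_linear with
  | zero => simp
  | add p q hp hq => simp only [map_add, hp, hq]
  | single n v => rw [lam_single, subst_single, subst_single, pow_succ']; rfl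

theorem subst_add (D : Module.End k W) (φ ψ : V →ₗ[k] W) (p : VPoly V) :
    subst D (φ + ψ) p = subst D φ p + subst D ψ p := by
  induction p using Finsupp.induction_linear with
  | zero => simp
  | add p q hp hq => simp only [map_add, hp, hq]; abel
  | single n v => simp [subst_single]

theorem subst_smul (D : Module.End k W) (φ : V →ₗ[k] W) (c : k) (p : VPoly V) :
    subst D (c • φ) p = c • subst D φ p := by
  induction p using Finsupp.induction_linear with
  | zero => simp
  | add p q hp hq => simp only [map_add, hp, hq, smul_add]
  | single n v => simp [subst_single]

/-- Linear maps intertwining the operators commute with substitution. -/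
theorem map_subst {Z : Type*} [AddCommGroup Z] [Module k Z] (g : W →ₗ[k] Z)
    (D : Module.End k W) (D' : Module.End k Z) (h : ∀ w, g (D w) = D' (g w))
    (φ : V →ₗ[k] W) (p : VPoly V) : g (subst D φ p) = subst D' (g ∘ₗ φ) p := by
  induction p using Finsupp.induction_linear with
  | zero => simp
  | add p q hp hq => simp only [map_add, hp, hq]
  | single n v =>
    rw [subst_single, subst_single, LinearMap.comp_apply]
    generalize φ v = w
    induction n generalizing w with
    | zero => simp
    | succ n ih => rw [pow_succ, pow_succ, Module.End.mul_apply, Module.End.mul_apply, ih, h]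

/-- The value `p(s)` of `p ∈ V[λ]` at a scalar `s`. -/
def ev (s : k) : VPoly V →ₗ[k] V := subst (s • 1) LinearMap.id

/-- The value `p(s, t)` of `p ∈ V[λ, μ]` at scalars `s`, `t`. -/
def ev₂ (s t : k) : VPoly₂ V →ₗ[k] V := ev s ∘ₗ ev t

theorem subst_scalar (s : k) (φ : V →ₗ[k] W) (p : VPoly V) :
    subst (s • 1) φ p = φ (ev s p) := by
  rw [ev, map_subst φ (s • 1) (s • 1) (by simp)]; rfl

theorem ev_lam (s : k) (p : VPoly V) : ev s (lam k V p) = s • ev s p := by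
  rw [ev, subst_lam]; simp

theorem ev_mapRange (s : k) (f : V →ₗ[k] W) (p : VPoly V) :
    ev s (Finsupp.mapRange.linearMap f p) = f (ev s p) := by
  induction p using Finsupp.induction_linear with
  | zero => simp
  | add p q hp hq => simp only [map_add, hp, hq]
  | single n v => simp [ev, subst_single, smul_pow]

theorem ev_const (s : k) (v : V) : ev s (const k V v) = v := by
  simp [ev, const, subst_single]

theorem del_eq_mapRange [Module k[X] V] [IsScalarTower k k[X] V] (p : VPoly V) :
    del k (VPoly V) p = Finsupp.mapRange.linearMap (del k V) p := by
  ext n; simp [del]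

theorem ev_del [Module k[X] V] [IsScalarTower k k[X] V] (s : k) (p : VPoly V) :
    ev s (del k (VPoly V) p) = del k V (ev s p) := by
  rw [del_eq_mapRange, ev_mapRange]

theorem ev₂_varL (s t : k) (p : VPoly₂ V) : ev₂ s t (varL k V p) = s • ev₂ s t p := by
  simp only [ev₂, varL, LinearMap.comp_apply, ev_mapRange, ev_lam]

theorem ev₂_varM (s t : k) (p : VPoly₂ V) : ev₂ s t (varM k V p) = t • ev₂ s t p := by
  simp only [ev₂, varM, LinearMap.comp_apply, ev_lam, map_smul]

theorem ev₂_const (s t : k) (v : V) : ev₂ s t (const₂ k V v) = v := by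
  simp only [ev₂, const₂, LinearMap.comp_apply, ev_const]

theorem ev₂_del [Module k[X] V] [IsScalarTower k k[X] V] (s t : k) (p : VPoly₂ V) :
    ev₂ s t (del k (VPoly₂ V) p) = del k V (ev₂ s t p) := by
  simp only [ev₂, LinearMap.comp_apply, ev_del]

/-- The value `p(-s-∂)`. -/
def evS [Module k[X] V] [IsScalarTower k k[X] V] (s : k) : VPoly V →ₗ[k] V :=
  subst (-(s • 1) - del k V) LinearMap.id

theorem ev_skew [Module k[X] V] [IsScalarTower k k[X] V] (s : k) (p : VPoly V) :
    ev s (skew k V p) = evS s p := by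
  rw [skew, map_subst (ev s) _ (-(s • 1) - del k V) (by simp [ev_lam, ev_del]), evS]
  congr 1
  exact congrArg _ (LinearMap.ext fun v => ev_const s v)

theorem ev₂_subst {U : Type*} [AddCommGroup U] [Module k U] (s t c : k)
    (D : Module.End k (VPoly₂ V))
    (h : ∀ w, ev₂ s t (D w) = c • ev₂ s t w) (φ : U →ₗ[k] VPoly₂ V) (p : VPoly U) :
    ev₂ s t (subst D φ p) = ev₂ s t (φ (ev c p)) := by
  rw [map_subst (ev₂ s t) D (c • 1) (by simpa using h), subst_scalar]; rfl

theorem ev₂_subst_const (s t c : k) (D : Module.End k (VPoly₂ V))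
    (h : ∀ w, ev₂ s t (D w) = c • ev₂ s t w) (p : VPoly V) :
    ev₂ s t (subst D (const₂ k V) p) = ev c p := by
  rw [ev₂_subst s t c D h, ev₂_const]

theorem ev₂_subst_const_del [Module k[X] V] [IsScalarTower k k[X] V] (s t c : k)
    (D : Module.End k (VPoly₂ V))
    (h : ∀ w, ev₂ s t (D w) = -(c • ev₂ s t w) - del k V (ev₂ s t w)) (p : VPoly V) :
    ev₂ s t (subst D (const₂ k V) p) = evS c p := by
  rw [map_subst (ev₂ s t) D (-(c • 1) - del k V) (by simpa using h), evS]
  congr 1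
  exact congrArg _ (LinearMap.ext fun v => ev₂_const s t v)

theorem vpoly_ext [Infinite k] {p q : VPoly V} (h : ∀ s : k, ev s p = ev s q) : p = q := by
  rw [← sub_eq_zero]
  have h' : ∀ s : k, ev s (p - q) = 0 := fun s => by rw [map_sub, h, sub_self]
  generalize p - q = p at h'
  ext n
  rw [Finsupp.zero_apply, ← Module.forall_dual_apply_eq_zero_iff k]
  intro ψ
  let P : VPoly V →ₗ[k] k[X] := subst (LinearMap.mulLeft k Polynomial.X)
    ((Algebra.linearMap k k[X]) ∘ₗ ψ)
  have hP : ∀ (p : VPoly V) (s : k), (P p).eval s = ψ (ev s p) := by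
    intro p s
    induction p using Finsupp.induction_linear with
    | zero => simp
    | add p q hp hq => simp only [map_add, hp, hq, Polynomial.eval_add]
    | single n v =>
      simp [P, ev, subst_single, LinearMap.pow_mulLeft, smul_pow]
      ring
  have hc : ∀ (p : VPoly V) (n : ℕ), (P p).coeff n = ψ (p n) := by
    intro p n
    induction p using Finsupp.induction_linear with
    | zero => simp
    | add p q hp hq => simp [hp, hq]
    | single m v =>
      simp only [P, subst_single, LinearMap.pow_mulLeft, LinearMap.comp_apply,
        LinearMap.mulLeft_apply, Algebra.linearMap_apply, Polynomial.algebraMap_eq]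
      rw [mul_comm, Polynomial.coeff_C_mul_X_pow]
      by_cases hmn : n = m
      · simp [hmn]
      · rw [if_neg hmn, Finsupp.single_apply, if_neg (Ne.symm hmn), map_zero]
  rw [← hc, Polynomial.funext (p := P p) (q := 0) (fun s => by rw [hP, h']; simp)]
  simp

theorem vpoly₂_ext [Infinite k] {p q : VPoly₂ V} (h : ∀ s t : k, ev₂ s t p = ev₂ s t q) :
    p = q :=
  vpoly_ext (k := k) fun t => vpoly_ext (k := k) fun s => h s t

end Eval

/-! ## Leibniz conformal algebras -/

/-- A Leibniz conformal algebra structure on the `k[∂]`-module `Q`. -/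
structure LeibnizConformalAlgebra (k : Type*) [Field k] (Q : Type*) [AddCommGroup Q]
    [Module k Q] [Module k[X] Q] [IsScalarTower k k[X] Q] where
  /-- the bracket `[a_λ b]` -/
  bracket : Q →ₗ[k] Q →ₗ[k] VPoly Q
  /-- `[∂a_λ b] = -λ[a_λ b]` -/
  del_left : ∀ a b, bracket (del k Q a) b = -lam k Q (bracket a b)
  /-- `[a_λ ∂b] = (λ + ∂)[a_λ b]` -/
  del_right : ∀ a b, bracket a (del k Q b) = (lam k Q + del k (VPoly Q)) (bracket a b)
  /-- `[a_λ [b_μ c]] = [[a_λ b]_{λ+μ} c] + [b_μ [a_λ c]]` in `Q[λ, μ]` -/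
  jacobi : ∀ a b c,
    subst (varM k Q) (subst (varL k Q) (const₂ k Q) ∘ₗ bracket a) (bracket b c) =
      subst (varL k Q) (subst (varL k Q + varM k Q) (const₂ k Q) ∘ₗ bracket.flip c)
          (bracket a b) +
        subst (varL k Q) (subst (varM k Q) (const₂ k Q) ∘ₗ bracket b) (bracket a c)

/-! ## Conformal linear maps and the conformal dual -/

section Twist

variable {k : Type*} [Field k] {A : Type*} [AddCommGroup A] [Module k A]

/-- The `k[∂]`-module structure in which `∂` acts by a given endomorphism. -/
abbrev moduleOfEnd (D : Module.End k A) : Module k[X] A :=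
  Module.compHom A (Polynomial.aeval (R := k) D).toRingHom

end Twist

section Chom

variable (k : Type*) [Field k]
  (U : Type*) [AddCommGroup U] [Module k U] [Module k[X] U] [IsScalarTower k k[X] U]
  (V : Type*) [AddCommGroup V] [Module k V] [Module k[X] V] [IsScalarTower k k[X] V]

/-- Conformal linear maps `a_λ : U → V[λ]`, i.e. `a_λ (∂u) = (λ + ∂) a_λ u`. -/
def chomSubmodule : Submodule k (U →ₗ[k] VPoly V) where
  carrier := {a | ∀ u, a (del k U u) = (lam k V + del k (VPoly V)) (a u)}
  add_mem' {a b} ha hb u := by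
    have ha' := ha u
    have hb' := hb u
    simp only [LinearMap.add_apply, map_add] at *
    rw [ha', hb']
  zero_mem' u := by simp
  smul_mem' c a ha u := by
    have ha' := ha u
    simp only [LinearMap.smul_apply, map_smul] at *
    rw [ha']

/-- `Chom(U, V)`. -/
def Chom : Type _ := chomSubmodule k U V

instance : AddCommGroup (Chom k U V) := inferInstanceAs (AddCommGroup (chomSubmodule k U V))
instance : Module k (Chom k U V) := inferInstanceAs (Module k (chomSubmodule k U V))

variable {k U V}

/-- The underlying map of a conformal linear map, `u ↦ a_λ u`. -/
def Chom.toLin : Chom k U V →ₗ[k] U →ₗ[k] VPoly V := (chomSubmodule k U V).subtype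

instance : CoeFun (Chom k U V) fun _ => U → VPoly V := ⟨fun a => a.toLin⟩

theorem Chom.map_del (a : Chom k U V) (u : U) :
    a (del k U u) = (lam k V + del k (VPoly V)) (a u) := a.2 u

theorem Chom.ext {a b : Chom k U V} (h : ∀ u, a u = b u) : a = b :=
  Subtype.ext (LinearMap.ext h)

theorem lam_comm_del (p : VPoly V) :
    lam k V (del k (VPoly V) p) = del k (VPoly V) (lam k V p) := by
  induction p using Finsupp.induction_linear with
  | zero => simp
  | add p q hp hq => simp [hp, hq]
  | single n v =>
    simp [lam, del, Finsupp.mapDomain_single]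

variable (k U V)

/-- The action of `∂` on `Chom(U, V)`: `(∂a)_λ u = -λ a_λ u`. -/
def Chom.delEnd : Module.End k (Chom k U V) where
  toFun a := ⟨-(lam k V ∘ₗ a.toLin), fun u => by
    have h := a.map_del u
    simp only [LinearMap.neg_apply, LinearMap.comp_apply, map_neg, LinearMap.add_apply] at *
    rw [h, map_add, lam_comm_del]⟩
  map_add' a b := Chom.ext fun u => by
    change -(lam k V ((a + b).toLin u)) = -(lam k V (a.toLin u)) + -(lam k V (b.toLin u))
    rw [map_add, LinearMap.add_apply, map_add, neg_add]
  map_smul' c a := Chom.ext fun u => by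
    change -(lam k V ((c • a).toLin u)) = c • -(lam k V (a.toLin u))
    rw [map_smul, LinearMap.smul_apply, map_smul, smul_neg]

instance : Module k[X] (Chom k U V) := moduleOfEnd (Chom.delEnd k U V)

instance : IsScalarTower k k[X] (Chom k U V) where
  smul_assoc c p a := by
    change Polynomial.aeval (Chom.delEnd k U V) (c • p) a =
      c • Polynomial.aeval (Chom.delEnd k U V) p a
    rw [map_smul]; rfl

theorem Chom.del_eq : del k (Chom k U V) = Chom.delEnd k U V := by
  ext1 a
  change Polynomial.aeval (Chom.delEnd k U V) Polynomial.X a = _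
  rw [Polynomial.aeval_X]

theorem Chom.del_apply (a : Chom k U V) (u : U) :
    (del k (Chom k U V) a) u = -lam k V (a u) := by
  rw [Chom.del_eq]; rfl

variable {k U V}

/-- A `k`-linear map commuting with `∂` is `k[∂]`-linear. -/
def linOfDel (f : U →ₗ[k] V) (h : ∀ u, f (del k U u) = del k V (f u)) : U →ₗ[k[X]] V where
  toFun := f
  map_add' := f.map_add
  map_smul' p u := by
    simp only [RingHom.id_apply]
    induction p using Polynomial.induction_on' generalizing u with
    | add p q hp hq => simp only [add_smul, map_add, hp, hq]
    | monomial n c =>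
      rw [← mul_one c, ← smul_eq_mul, ← Polynomial.smul_monomial, ← Polynomial.X_pow_eq_monomial,
        smul_assoc, smul_assoc, map_smul]
      congr 1
      induction n generalizing u with
      | zero => simp
      | succ n ih =>
        rw [pow_succ, mul_smul, mul_smul, ih]
        congr 1
        exact h u

/-- `T_0 = T_λ|_{λ=0}`, which is a homomorphism of `k[∂]`-modules. -/
def Chom.atZero (T : Chom k U V) : U →ₗ[k[X]] V :=
  linOfDel (Finsupp.lapply 0 ∘ₗ T.toLin) fun u => by
    have h := T.map_del u
    simp only [LinearMap.comp_apply, Finsupp.lapply_apply]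
    rw [h]
    have : (lam k V (T u)) 0 = 0 := by
      simp only [lam, Finsupp.lmapDomain_apply]
      exact Finsupp.mapDomain_of_notMem_range _ _ (by simp)
    simp [this, del]

end Chom

section Dual

variable (k : Type*) [Field k]
  (U : Type*) [AddCommGroup U] [Module k U] [Module k[X] U] [IsScalarTower k k[X] U]

/-- `k`-linear maps `f : U → k[λ]` with `f_λ (∂u) = λ f_λ u`. -/
def cdualSubmodule : Submodule k (U →ₗ[k] k[X]) where
  carrier := {f | ∀ u, f (del k U u) = Polynomial.X * f u}
  add_mem' {f g} hf hg u := by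
    have hf' := hf u
    have hg' := hg u
    simp only [LinearMap.add_apply] at *
    rw [hf', hg', mul_add]
  zero_mem' u := by simp
  smul_mem' c f hf u := by
    have hf' := hf u
    simp only [LinearMap.smul_apply] at *
    rw [hf', mul_smul_comm]

/-- The conformal dual `U^{*c} = Chom(U, k)`, with `∂` acting trivially on `k`. -/
def CDual : Type _ := cdualSubmodule k U

instance : AddCommGroup (CDual k U) := inferInstanceAs (AddCommGroup (cdualSubmodule k U))
instance : Module k (CDual k U) := inferInstanceAs (Module k (cdualSubmodule k U))

variable {k U}

/-- The pairing `f, u ↦ ⟨f, u⟩_λ = f_λ u`. -/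
def pair : CDual k U →ₗ[k] U →ₗ[k] k[X] := (cdualSubmodule k U).subtype

theorem CDual.ext {f g : CDual k U} (h : ∀ u, pair f u = pair g u) : f = g :=
  Subtype.ext (LinearMap.ext h)

theorem pair_del (f : CDual k U) (u : U) : pair f (del k U u) = Polynomial.X * pair f u := f.2 u

variable (k U)

variable {k U}

/-- Constructor for elements of the conformal dual. -/
def CDual.mk (f : U →ₗ[k] k[X]) (h : ∀ u, f (del k U u) = Polynomial.X * f u) : CDual k U := ⟨f, h⟩

theorem pair_mk (f : U →ₗ[k] k[X]) (h : ∀ u, f (del k U u) = Polynomial.X * f u) :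
    pair (CDual.mk f h) = f := rfl

variable (k U)

/-- The action of `∂` on `U^{*c}`: `⟨∂f, u⟩_λ = -λ ⟨f, u⟩_λ`. -/
def CDual.delEnd : Module.End k (CDual k U) where
  toFun f := CDual.mk (-(LinearMap.mulLeft k (Polynomial.X : k[X]) ∘ₗ pair f)) fun u => by
    simp [pair_del]
  map_add' f g := CDual.ext fun u => by
    simp only [map_add, pair_mk, LinearMap.add_apply, LinearMap.neg_apply, LinearMap.comp_apply,
      LinearMap.mulLeft_apply]
    ring
  map_smul' c f := CDual.ext fun u => by
    simp only [map_smul, pair_mk, LinearMap.smul_apply, LinearMap.neg_apply,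
      LinearMap.comp_apply, RingHom.id_apply, smul_neg]

instance : Module k[X] (CDual k U) := moduleOfEnd (CDual.delEnd k U)

instance : IsScalarTower k k[X] (CDual k U) where
  smul_assoc c p a := by
    change Polynomial.aeval (CDual.delEnd k U) (c • p) a =
      c • Polynomial.aeval (CDual.delEnd k U) p a
    rw [map_smul]; rfl

theorem CDual.del_eq : del k (CDual k U) = CDual.delEnd k U := by
  ext1 a
  change Polynomial.aeval (CDual.delEnd k U) Polynomial.X a = _
  rw [Polynomial.aeval_X]

theorem pair_del_left (f : CDual k U) (u : U) :
    pair (del k (CDual k U) f) u = -(Polynomial.X * pair f u) := by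
  rw [CDual.del_eq]
  simp [CDual.delEnd, pair_mk]

end Dual

/-! ## Dual actions -/

section DualAction

variable {k : Type*} [Field k]
  {M : Type*} [AddCommGroup M] [Module k M] [Module k[X] M] [IsScalarTower k k[X] M]

/-- `v ↦ -⟨f, g_λ v⟩_{μ-λ}` as an element of `k[μ][λ]`. -/
def dualPoly (g : Chom k M M) (f : CDual k M) : M →ₗ[k] k[X][X] :=
  -(subst (LinearMap.mulLeft k (Polynomial.X : k[X][X]))
      ((Polynomial.aeval (Polynomial.C Polynomial.X - Polynomial.X : k[X][X])).toLinearMap ∘ₗ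
        pair f) ∘ₗ g.toLin)

theorem dualPoly_del (g : Chom k M M) (f : CDual k M) (v : M) :
    dualPoly g f (del k M v) = Polynomial.C Polynomial.X * dualPoly g f v := by
  have key : ∀ p : VPoly M,
      subst (LinearMap.mulLeft k (Polynomial.X : k[X][X]))
        ((Polynomial.aeval (Polynomial.C Polynomial.X - Polynomial.X : k[X][X])).toLinearMap ∘ₗ
        pair f) ((lam k M + del k (VPoly M)) p) =
      Polynomial.C Polynomial.X * subst (LinearMap.mulLeft k (Polynomial.X : k[X][X]))
        ((Polynomial.aeval (Polynomial.C Polynomial.X - Polynomial.X : k[X][X])).toLinearMap ∘ₗ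
        pair f) p := by
    intro p
    rw [LinearMap.add_apply, map_add, subst_lam, LinearMap.mulLeft_apply]
    induction p using Finsupp.induction_linear with
    | zero => simp
    | add p q hp hq =>
      simp only [map_add, mul_add] at *
      rw [← hp, ← hq]; abel
    | single n v =>
      have : del k (VPoly M) (Finsupp.single n v) = Finsupp.single n (del k M v) := by
        simp [del]
      rw [this]
      simp [subst, LinearMap.pow_mulLeft, pair_del]
      ring
  have h := key (g v)
  rw [← g.map_del] at h
  rw [dualPoly, LinearMap.neg_apply, LinearMap.neg_apply, LinearMap.comp_apply,
    LinearMap.comp_apply, h]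
  ring

theorem dualPoly_bounded [Module.Finite k[X] M] (g : Chom k M M) (f : CDual k M) :
    ∃ N : ℕ, ∀ v, ∀ n, N ≤ n → (dualPoly g f v).coeff n = 0 := by
  let B : M →ₗ[k[X]] k[X][X] := linOfDel (dualPoly g f) fun v => by
    rw [dualPoly_del, ← Polynomial.smul_eq_C_mul]; rfl
  obtain ⟨S, hS⟩ := (Module.Finite.fg_top : (⊤ : Submodule k[X] M).FG)
  refine ⟨S.sup fun v => (B v).natDegree + 1, fun v n hn => ?_⟩
  have hv : v ∈ Submodule.span k[X] (S : Set M) := hS ▸ Submodule.mem_top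
  change (B v).coeff n = 0
  induction hv using Submodule.span_induction with
  | mem x hx =>
    have : (B x).natDegree + 1 ≤ S.sup fun v => (B v).natDegree + 1 :=
      Finset.le_sup (f := fun v => (B v).natDegree + 1) hx
    exact Polynomial.coeff_eq_zero_of_natDegree_lt (by omega)
  | zero => simp
  | add x y _ _ hx hy => simp [hx, hy]
  | smul a x _ hx => rw [map_smul, Polynomial.coeff_smul, hx, smul_zero]

/-- The coefficient of `λ ^ n` in `g*_λ f`. -/
def dualCoeff (g : Chom k M M) (f : CDual k M) (n : ℕ) : CDual k M :=
  CDual.mk (((Polynomial.lcoeff k[X] n).restrictScalars k) ∘ₗ dualPoly g f) fun v => by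
    simp [dualPoly_del]

theorem pair_dualCoeff (g : Chom k M M) (f : CDual k M) (n : ℕ) (v : M) :
    pair (dualCoeff g f n) v = (dualPoly g f v).coeff n := rfl

theorem dual_ext {p q : VPoly (CDual k M)} (h : ∀ n v, pair (p n) v = pair (q n) v) :
    p = q :=
  Finsupp.ext fun n => CDual.ext fun v => h n v

theorem dualPoly_add (g : Chom k M M) (f f' : CDual k M) (v : M) :
    dualPoly g (f + f') v = dualPoly g f v + dualPoly g f' v := by
  simp only [dualPoly, LinearMap.neg_apply, LinearMap.comp_apply, map_add, LinearMap.comp_add,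
    subst_add, neg_add]

theorem dualPoly_smul (g : Chom k M M) (c : k) (f : CDual k M) (v : M) :
    dualPoly g (c • f) v = c • dualPoly g f v := by
  simp only [dualPoly, LinearMap.neg_apply, LinearMap.comp_apply, map_smul, LinearMap.comp_smul,
    subst_smul, smul_neg]

theorem dualPoly_add_left (g g' : Chom k M M) (f : CDual k M) (v : M) :
    dualPoly (g + g') f v = dualPoly g f v + dualPoly g' f v := by
  simp only [dualPoly, LinearMap.neg_apply, LinearMap.comp_apply, map_add, LinearMap.add_apply,
    neg_add]

theorem dualPoly_smul_left (g : Chom k M M) (c : k) (f : CDual k M) (v : M) :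
    dualPoly (c • g) f v = c • dualPoly g f v := by
  simp only [dualPoly, LinearMap.neg_apply, LinearMap.comp_apply, map_smul, LinearMap.smul_apply,
    smul_neg]

theorem dualPoly_del_left (g : Chom k M M) (f : CDual k M) (v : M) :
    dualPoly (del k (Chom k M M) g) f v = -(Polynomial.X * dualPoly g f v) := by
  rw [dualPoly, dualPoly, LinearMap.neg_apply, LinearMap.neg_apply, LinearMap.comp_apply,
    LinearMap.comp_apply, Chom.del_apply, map_neg, subst_lam, LinearMap.mulLeft_apply]
  ring

theorem dualPoly_del_mid (g : Chom k M M) (f : CDual k M) (v : M) :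
    dualPoly g (del k (CDual k M) f) v =
      (Polynomial.X - Polynomial.C Polynomial.X) * dualPoly g f v := by
  rw [dualPoly, dualPoly, LinearMap.neg_apply, LinearMap.neg_apply, LinearMap.comp_apply,
    LinearMap.comp_apply]
  generalize g.toLin v = p
  suffices h : subst (LinearMap.mulLeft k (Polynomial.X : k[X][X]))
      ((Polynomial.aeval (Polynomial.C Polynomial.X - Polynomial.X : k[X][X])).toLinearMap ∘ₗ
        pair (del k (CDual k M) f)) p =
      (Polynomial.X - Polynomial.C Polynomial.X) *
        subst (LinearMap.mulLeft k (Polynomial.X : k[X][X]))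
      ((Polynomial.aeval (Polynomial.C Polynomial.X - Polynomial.X : k[X][X])).toLinearMap ∘ₗ
        pair f) p by
    rw [h]; ring
  induction p using Finsupp.induction_linear with
  | zero => simp
  | add p q hp hq => simp only [map_add, hp, hq, mul_add]
  | single n v =>
    simp only [subst_single, LinearMap.pow_mulLeft, LinearMap.mulLeft_apply,
      LinearMap.comp_apply, pair_del_left, AlgHom.toLinearMap_apply, map_neg, map_mul,
      Polynomial.aeval_X]
    ring

theorem lam_coeff_dual (P : VPoly (CDual k M)) (B : k[X][X]) (v : M)
    (h : ∀ n, pair (P n) v = B.coeff n) (n : ℕ) :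
    pair ((lam k _ P) n) v = (Polynomial.X * B).coeff n := by
  cases n with
  | zero => rw [lam_zero]; simp
  | succ n => rw [lam_succ, h, Polynomial.coeff_X_mul]

variable [Module.Finite k[X] M]

/-- `g*_λ f ∈ M^{*c}[λ]`, determined by `⟨g*_λ f, v⟩_μ = -⟨f, g_λ v⟩_{μ-λ}`. -/
def dualVal (g : Chom k M M) (f : CDual k M) : VPoly (CDual k M) :=
  Finsupp.onFinset (Finset.range (dualPoly_bounded g f).choose) (dualCoeff g f) fun n hn => by
    by_contra h
    exact hn (CDual.ext fun v => by
      rw [pair_dualCoeff, (dualPoly_bounded g f).choose_spec v n (by simpa using h)]; simp)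

theorem dualVal_apply (g : Chom k M M) (f : CDual k M) (n : ℕ) (v : M) :
    pair (dualVal g f n) v = (dualPoly g f v).coeff n := rfl

/-- The conformal endomorphism `g*` of `M^{*c}` with `⟨g*_λ f, v⟩_μ = -⟨f, g_λ v⟩_{μ-λ}`. -/
def dualChom (g : Chom k M M) : Chom k (CDual k M) (CDual k M) :=
  ⟨{ toFun := dualVal g
     map_add' := fun f f' => dual_ext fun n v => by
      simp only [Finsupp.add_apply, map_add, LinearMap.add_apply, dualVal_apply, dualPoly_add,
        Polynomial.coeff_add]
     map_smul' := fun c f => dual_ext fun n v => by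
      simp only [Finsupp.smul_apply, map_smul, LinearMap.smul_apply, dualVal_apply,
        dualPoly_smul, Polynomial.coeff_smul, RingHom.id_apply] }, fun f => dual_ext fun n v => by
      change pair (dualVal g (del k _ f) n) v =
        pair ((lam k _ (dualVal g f)) n + (del k _ (dualVal g f)) n) v
      rw [dualVal_apply, dualPoly_del_mid, sub_mul, Polynomial.coeff_sub,
        Polynomial.coeff_C_mul, map_add, LinearMap.add_apply, del_coeff, pair_del_left,
        dualVal_apply, lam_coeff_dual _ _ v (fun n => dualVal_apply g f n v), sub_eq_add_neg]⟩

theorem dualChom_apply (g : Chom k M M) (f : CDual k M) (n : ℕ) (v : M) :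
    pair (dualChom g f n) v = (dualPoly g f v).coeff n := rfl

variable (k M) in
/-- `g ↦ g*`, as a homomorphism of `k[∂]`-modules `Cend(M) → Cend(M^{*c})`. -/
def dualCend : Chom k M M →ₗ[k[X]] Chom k (CDual k M) (CDual k M) :=
  linOfDel
    { toFun := dualChom
      map_add' := fun g g' => Chom.ext fun f => dual_ext fun n v => by
        rw [map_add, LinearMap.add_apply, Finsupp.add_apply, map_add, LinearMap.add_apply,
          dualChom_apply, dualChom_apply, dualChom_apply, dualPoly_add_left,
          Polynomial.coeff_add]
      map_smul' := fun c g => Chom.ext fun f => dual_ext fun n v => by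
        rw [RingHom.id_apply, map_smul, LinearMap.smul_apply, Finsupp.smul_apply, map_smul,
          LinearMap.smul_apply]
        rw [dualChom_apply, dualChom_apply, dualPoly_smul_left, Polynomial.coeff_smul] }
    fun g => Chom.ext fun f => dual_ext fun n v => by
      change pair (dualChom (del k _ g) f n) v = pair ((del k (Chom k _ _) (dualChom g)) f n) v
      rw [Chom.del_apply, Finsupp.neg_apply, map_neg, LinearMap.neg_apply,
        lam_coeff_dual _ (dualPoly g f v) v fun n => dualChom_apply g f n v,
        dualChom_apply, dualPoly_del_left, Polynomial.coeff_neg]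

/-- The defining property of the dual action, at scalars. -/
theorem pair_ev_dual (g : Chom k M M) (f : CDual k M) (v : M) (s u : k) :
    (pair (ev s (dualCend k M g f)) v).eval u = -(pair f (ev s (g v))).eval (u - s) := by
  have h1 : ∀ P : VPoly (CDual k M), ∀ B : k[X][X], (∀ n, pair (P n) v = B.coeff n) →
      (pair (ev s P) v).eval u = (B.eval (Polynomial.C s)).eval u := by
    intro P B h
    have hB : ∀ P : VPoly (CDual k M), pair (ev s P) v =
        (subst (LinearMap.mulLeft k (Polynomial.X : k[X][X]))
          ((Algebra.linearMap k[X] k[X][X]).restrictScalars k ∘ₗ pair.flip v) P).eval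
            (Polynomial.C s) := by
      intro P
      induction P using Finsupp.induction_linear with
      | zero => simp
      | add p q hp hq => simp only [map_add, LinearMap.add_apply, hp, hq, Polynomial.eval_add]
      | single n f =>
        simp [ev, subst_single, LinearMap.pow_mulLeft, smul_pow, Polynomial.smul_eq_C_mul]
        ring
    rw [hB]
    congr 2
    ext1 n
    rw [← h]
    clear h hB
    induction P using Finsupp.induction_linear with
    | zero => simp
    | add p q hp hq =>
      simp only [map_add, LinearMap.add_apply, hp, hq, Polynomial.coeff_add, Finsupp.add_apply]
    | single m f =>
      simp only [subst_single, LinearMap.pow_mulLeft, LinearMap.comp_apply,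
        LinearMap.mulLeft_apply, LinearMap.restrictScalars_apply, Algebra.linearMap_apply,
        Polynomial.algebraMap_eq, LinearMap.flip_apply]
      rw [mul_comm, Polynomial.coeff_C_mul_X_pow]
      by_cases hmn : n = m
      · simp [hmn]
      · rw [if_neg hmn, Finsupp.single_apply, if_neg (Ne.symm hmn), map_zero,
          LinearMap.zero_apply]
  rw [h1 (dualCend k M g f) (dualPoly g f v) fun n => dualChom_apply g f n v]
  have h2 : ∀ p : VPoly M,
      ((subst (LinearMap.mulLeft k (Polynomial.X : k[X][X]))
        ((Polynomial.aeval (Polynomial.C Polynomial.X - Polynomial.X : k[X][X])).toLinearMap ∘ₗ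
        pair f) p).eval (Polynomial.C s)).eval u = (pair f (ev s p)).eval (u - s) := by
    intro p
    induction p using Finsupp.induction_linear with
    | zero => simp
    | add p q hp hq => simp only [map_add, hp, hq, Polynomial.eval_add]
    | single n w =>
      have h3 : ∀ q : k[X], ((Polynomial.aeval
          (Polynomial.C Polynomial.X - Polynomial.X : k[X][X]) q).eval
            (Polynomial.C s)).eval u = q.eval (u - s) := by
        intro q
        induction q using Polynomial.induction_on' with
        | add p q hp hq => simp only [map_add, hp, hq, Polynomial.eval_add]
        | monomial n c =>
          simp [Polynomial.aeval_monomial, Polynomial.algebraMap_apply]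
      simp [subst_single, LinearMap.pow_mulLeft, ev, smul_pow, h3]
  rw [← h2 (g v)]
  have h4 : dualPoly g f v = -(subst (LinearMap.mulLeft k (Polynomial.X : k[X][X]))
        ((Polynomial.aeval (Polynomial.C Polynomial.X - Polynomial.X : k[X][X])).toLinearMap ∘ₗ
        pair f) (g v)) := rfl
  rw [h4, Polynomial.eval_neg, Polynomial.eval_neg]

end DualAction

/-! ## Representations -/

/-- A representation `(M, l, r)` of a Leibniz conformal algebra; `l a v` is `l(a)_λ v`. -/
structure Representation {k : Type*} [Field k] {Q : Type*} [AddCommGroup Q] [Module k Q]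
    [Module k[X] Q] [IsScalarTower k k[X] Q] (L : LeibnizConformalAlgebra k Q)
    (M : Type*) [AddCommGroup M] [Module k M] [Module k[X] M] [IsScalarTower k k[X] M] where
  /-- the left action `l : Q → Cend(M)` -/
  l : Q →ₗ[k[X]] Chom k M M
  /-- the right action `r : Q → Cend(M)` -/
  r : Q →ₗ[k[X]] Chom k M M
  /-- `l(a)_λ (l(b)_μ v) = l([a_λ b])_{λ+μ} v + l(b)_μ (l(a)_λ v)` -/
  left_left : ∀ a b v,
    subst (varM k M) (subst (varL k M) (const₂ k M) ∘ₗ (l a).toLin) (l b v) =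
      subst (varL k M) (subst (varL k M + varM k M) (const₂ k M) ∘ₗ
          Chom.toLin.flip v ∘ₗ l.restrictScalars k) (L.bracket a b) +
        subst (varL k M) (subst (varM k M) (const₂ k M) ∘ₗ (l b).toLin) (l a v)
  /-- `l(a)_λ (r(b)_{-μ-∂} v) = r(b)_{-λ-μ-∂} (l(a)_λ v) + r([a_λ b])_{-μ-∂} v` -/
  left_right : ∀ a b v,
    subst (varM k M) (subst (varL k M) (const₂ k M) ∘ₗ (l a).toLin) (skew k M (r b v)) =
      subst (varL k M) (subst (-varL k M - varM k M - del k (VPoly₂ M)) (const₂ k M) ∘ₗ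
          (r b).toLin) (l a v) +
        subst (varL k M) (subst (-varM k M - del k (VPoly₂ M)) (const₂ k M) ∘ₗ
          Chom.toLin.flip v ∘ₗ r.restrictScalars k) (L.bracket a b)
  /-- `r(b)_{-λ-μ-∂} (r(a)_{-μ-∂} v) = -r(b)_{-λ-μ-∂} (l(a)_λ v)` -/
  right_right : ∀ a b v,
    subst (varM k M) (subst (-varL k M - varM k M - del k (VPoly₂ M)) (const₂ k M) ∘ₗ
        (r b).toLin) (skew k M (r a v)) =
      -subst (varL k M) (subst (-varL k M - varM k M - del k (VPoly₂ M)) (const₂ k M) ∘ₗ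
        (r b).toLin) (l a v)

/-! ### The identities at scalars -/

section Scalars

variable {k : Type*} [Field k]
  {Q : Type*} [AddCommGroup Q] [Module k Q] [Module k[X] Q] [IsScalarTower k k[X] Q]
  {M : Type*} [AddCommGroup M] [Module k M] [Module k[X] M] [IsScalarTower k k[X] M]

theorem evS_lam (s : k) (p : VPoly M) :
    evS s (lam k M p) = -(s • evS s p) - del k M (evS s p) := by
  rw [evS, subst_lam]; simp

theorem evS_del (s : k) (p : VPoly M) : evS s (del k (VPoly M) p) = del k M (evS s p) := by
  rw [evS, map_subst (del k M) _ (-(s • 1) - del k M) (by simp), del_eq_mapRange]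
  induction p using Finsupp.induction_linear with
  | zero => simp
  | add p q hp hq => simp only [map_add, hp, hq]
  | single n v => simp [subst_single]

/-- A functional on which `∂` acts by the scalar `c` turns `p(-s-∂)` into `p(-s-c)`. -/
theorem map_evS {Z : Type*} [AddCommGroup Z] [Module k Z] (ψ : M →ₗ[k] Z) (c s : k)
    (h : ∀ w, ψ (del k M w) = c • ψ w) (p : VPoly M) : ψ (evS s p) = ψ (ev (-s - c) p) := by
  rw [evS, map_subst ψ _ ((-s - c) • 1) (fun w => by simp [h, sub_smul]), subst_scalar]
  rfl

theorem lin_map_del (l : Q →ₗ[k[X]] Chom k M M) (a : Q) :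
    l (del k Q a) = del k (Chom k M M) (l a) := map_smul l _ a

theorem lin_ev (l : Q →ₗ[k[X]] Chom k M M) (v : M) (c : k) (p : VPoly Q) :
    (Chom.toLin.flip v ∘ₗ l.restrictScalars k) (ev c p) = l (ev c p) v := rfl

variable (s t : k)

theorem ev_chom_del (g : Chom k M M) (v : M) :
    ev s (g (del k M v)) = s • ev s (g v) + del k M (ev s (g v)) := by
  rw [g.map_del, LinearMap.add_apply, map_add, ev_lam, ev_del]

theorem jacobi_left (b : Q →ₗ[k] Q →ₗ[k] VPoly Q) (x y z : Q) :
    ev₂ s t (subst (varM k Q) (subst (varL k Q) (const₂ k Q) ∘ₗ b x) (b y z)) =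
      ev s (b x (ev t (b y z))) := by
  rw [ev₂_subst s t t _ (ev₂_varM s t), LinearMap.comp_apply,
    ev₂_subst_const s t s _ (ev₂_varL s t)]

theorem jacobi_right (b : Q →ₗ[k] Q →ₗ[k] VPoly Q) (x y z : Q) :
    ev₂ s t (subst (varL k Q) (subst (varL k Q + varM k Q) (const₂ k Q) ∘ₗ b.flip z)
          (b x y) +
        subst (varL k Q) (subst (varM k Q) (const₂ k Q) ∘ₗ b y) (b x z)) =
      ev (s + t) (b (ev s (b x y)) z) + ev t (b y (ev s (b x z))) := by
  rw [map_add, ev₂_subst s t s _ (ev₂_varL s t), ev₂_subst s t s _ (ev₂_varL s t),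
    LinearMap.comp_apply, LinearMap.comp_apply, ev₂_subst_const s t (s + t),
    ev₂_subst_const s t t _ (ev₂_varM s t), LinearMap.flip_apply]
  intro w
  rw [LinearMap.add_apply, map_add, ev₂_varL, ev₂_varM, add_smul]

theorem eval_ll (g : Chom k M M) (p : VPoly M) :
    ev₂ s t (subst (varM k M) (subst (varL k M) (const₂ k M) ∘ₗ g.toLin) p) =
      ev s (g (ev t p)) := by
  rw [ev₂_subst s t t _ (ev₂_varM s t), LinearMap.comp_apply,
    ev₂_subst_const s t s _ (ev₂_varL s t)]

theorem eval_ll' (g : Chom k M M) (p : VPoly M) :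
    ev₂ s t (subst (varL k M) (subst (varM k M) (const₂ k M) ∘ₗ g.toLin) p) =
      ev t (g (ev s p)) := by
  rw [ev₂_subst s t s _ (ev₂_varL s t), LinearMap.comp_apply,
    ev₂_subst_const s t t _ (ev₂_varM s t)]

theorem eval_bl (l : Q →ₗ[k[X]] Chom k M M) (v : M) (p : VPoly Q) :
    ev₂ s t (subst (varL k M) (subst (varL k M + varM k M) (const₂ k M) ∘ₗ
          Chom.toLin.flip v ∘ₗ l.restrictScalars k) p) = ev (s + t) (l (ev s p) v) := by
  rw [ev₂_subst s t s _ (ev₂_varL s t), LinearMap.comp_apply, ev₂_subst_const s t (s + t)]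
  · rfl
  intro w
  rw [LinearMap.add_apply, map_add, ev₂_varL, ev₂_varM, add_smul]

theorem evD_lm (w : VPoly₂ M) :
    ev₂ s t ((-varL k M - varM k M - del k (VPoly₂ M)) w) =
      -((s + t) • ev₂ s t w) - del k M (ev₂ s t w) := by
  simp only [LinearMap.sub_apply, LinearMap.neg_apply, map_sub, map_neg, ev₂_varL, ev₂_varM,
    ev₂_del, add_smul]
  abel

theorem evD_m (w : VPoly₂ M) :
    ev₂ s t ((-varM k M - del k (VPoly₂ M)) w) =
      -(t • ev₂ s t w) - del k M (ev₂ s t w) := by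
  simp only [LinearMap.sub_apply, LinearMap.neg_apply, map_sub, map_neg, ev₂_varM, ev₂_del]

theorem eval_rl (g : Chom k M M) (p : VPoly M) :
    ev₂ s t (subst (varL k M) (subst (-varL k M - varM k M - del k (VPoly₂ M)) (const₂ k M) ∘ₗ
          g.toLin) p) = evS (s + t) (g (ev s p)) := by
  rw [ev₂_subst s t s _ (ev₂_varL s t), LinearMap.comp_apply,
    ev₂_subst_const_del s t (s + t) _ (evD_lm s t)]

theorem eval_rr (g : Chom k M M) (p : VPoly M) :
    ev₂ s t (subst (varM k M) (subst (-varL k M - varM k M - del k (VPoly₂ M)) (const₂ k M) ∘ₗ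
          g.toLin) p) = evS (s + t) (g (ev t p)) := by
  rw [ev₂_subst s t t _ (ev₂_varM s t), LinearMap.comp_apply,
    ev₂_subst_const_del s t (s + t) _ (evD_lm s t)]

theorem eval_br (l : Q →ₗ[k[X]] Chom k M M) (v : M) (p : VPoly Q) :
    ev₂ s t (subst (varL k M) (subst (-varM k M - del k (VPoly₂ M)) (const₂ k M) ∘ₗ
          Chom.toLin.flip v ∘ₗ l.restrictScalars k) p) = evS t (l (ev s p) v) := by
  rw [ev₂_subst s t s _ (ev₂_varL s t), LinearMap.comp_apply,
    ev₂_subst_const_del s t t _ (evD_m s t)]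
  rfl

variable {L : LeibnizConformalAlgebra k Q} (ρ : Representation L M)

theorem LeibnizConformalAlgebra.jacobi_ev (L : LeibnizConformalAlgebra k Q) (a b c : Q) :
    ev s (L.bracket a (ev t (L.bracket b c))) =
      ev (s + t) (L.bracket (ev s (L.bracket a b)) c) +
        ev t (L.bracket b (ev s (L.bracket a c))) := by
  rw [← jacobi_left, L.jacobi, jacobi_right]

namespace Representation

theorem left_left_ev (a b : Q) (v : M) :
    ev s (ρ.l a (ev t (ρ.l b v))) =
      ev (s + t) (ρ.l (ev s (L.bracket a b)) v) + ev t (ρ.l b (ev s (ρ.l a v))) := by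
  rw [← eval_ll, ρ.left_left, map_add, eval_bl, eval_ll']

theorem left_right_ev (a b : Q) (v : M) :
    ev s (ρ.l a (evS t (ρ.r b v))) =
      evS (s + t) (ρ.r b (ev s (ρ.l a v))) + evS t (ρ.r (ev s (L.bracket a b)) v) := by
  rw [← ev_skew, ← eval_ll, ρ.left_right, map_add, eval_rl, eval_br]

theorem right_right_ev (a b : Q) (v : M) :
    evS (s + t) (ρ.r b (evS t (ρ.r a v))) = -evS (s + t) (ρ.r b (ev s (ρ.l a v))) := by
  rw [← ev_skew t, ← eval_rr, ρ.right_right, map_neg, eval_rl]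

end Representation

theorem del_prod (x : Q × M) : del k (Q × M) x = (del k Q x.1, del k M x.2) := rfl

/-- The functional `w ↦ ⟨f, w⟩_u`. -/
def pairAt (f : CDual k M) (u : k) : M →ₗ[k] k := Polynomial.leval u ∘ₗ pair f

theorem pairAt_apply (f : CDual k M) (u : k) (w : M) : pairAt f u w = (pair f w).eval u := rfl

theorem pairAt_del (f : CDual k M) (u : k) (w : M) :
    pairAt f u (del k M w) = u • pairAt f u w := by
  simp [pairAt, pair_del]

theorem pair_evS (P : VPoly (CDual k M)) (v : M) (s u : k) :
    (pair (evS s P) v).eval u = (pair (ev (u - s) P) v).eval u := by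
  have := map_evS (Polynomial.leval u ∘ₗ pair.flip v : CDual k M →ₗ[k] k) (-u) s
    (fun f => by simp [pair_del_left]) P
  rw [show -s - -u = u - s by ring] at this
  exact this


theorem pairAt_add (f g : CDual k M) (u : k) (v : M) :
    pairAt (f + g) u v = pairAt f u v + pairAt g u v := by
  simp [pairAt_apply]

theorem pairAt_neg (f : CDual k M) (u : k) (v : M) : pairAt (-f) u v = -pairAt f u v := by
  simp [pairAt_apply]

theorem pairAt_evS (P : VPoly (CDual k M)) (v : M) (s u : k) :
    pairAt (evS s P) u v = pairAt (ev (u - s) P) u v :=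
  pair_evS P v s u

theorem Representation.pairAt_left_right (ρ : Representation L M) (f : CDual k M) (t s w : k)
    (a b : Q) (v : M) :
    pairAt f t (ev s (ρ.l a (ev w (ρ.r b v)))) =
      pairAt f t (ev w (ρ.r b (ev s (ρ.l a v)))) +
        pairAt f t (ev (s + w) (ρ.r (ev s (L.bracket a b)) v)) := by
  have h := congrArg (pairAt f t) (ρ.left_right_ev s (-w - s - t) a b v)
  have h' := map_evS (pairAt f t ∘ₗ ev s ∘ₗ (ρ.l a).toLin) (s + t) (-w - s - t)
    (fun x => by
      simp only [LinearMap.comp_apply, ev_chom_del, map_add, map_smul, pairAt_del, add_smul])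
    (ρ.r b v)
  simp only [LinearMap.comp_apply] at h'
  rw [map_add, h', map_evS (pairAt f t) t _ (pairAt_del f t),
    map_evS (pairAt f t) t _ (pairAt_del f t)] at h
  rw [show -(-w - s - t) - (s + t) = w by ring, show -(s + (-w - s - t)) - t = w by ring,
    show -(-w - s - t) - t = s + w by ring] at h
  exact h

theorem Representation.pairAt_right_right (ρ : Representation L M) (f : CDual k M) (u s y : k)
    (a b : Q) (v : M) :
    pairAt f u (ev y (ρ.r b (ev s (ρ.r a v)))) =
      -pairAt f u (ev y (ρ.r b (ev s (ρ.l a v)))) := by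
  have h := congrArg (pairAt f u) (ρ.right_right_ev s (-s - u - y) a b v)
  rw [map_neg, map_evS (pairAt f u) u _ (pairAt_del f u),
    map_evS (pairAt f u) u _ (pairAt_del f u), show -(s + (-s - u - y)) - u = y by ring] at h
  have h' := map_evS (pairAt f u ∘ₗ ev y ∘ₗ (ρ.r b).toLin) (y + u) (-s - u - y)
    (fun x => by
      simp only [LinearMap.comp_apply, ev_chom_del, map_add, map_smul, pairAt_del, add_smul])
    (ρ.r a v)
  simp only [LinearMap.comp_apply] at h'
  rw [h', show -(-s - u - y) - (y + u) = s by ring] at h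
  exact h

/-- The `λ`-bracket `[(a + x)_λ (b + y)] = [a_λ b] + l(a)_λ y + r(b)_{-λ-∂} x` on `Q ⊕ M`. -/
def Representation.semidirectBracket (ρ : Representation L M) :
    (Q × M) →ₗ[k] (Q × M) →ₗ[k] VPoly (Q × M) :=
  LinearMap.mk₂ k
    (fun x y => Finsupp.mapRange.linearMap (LinearMap.inl k Q M) (L.bracket x.1 y.1) +
      Finsupp.mapRange.linearMap (LinearMap.inr k Q M)
        (ρ.l x.1 y.2 + skew k M (ρ.r y.1 x.2)))
    (fun x x' y => by
      simp only [Prod.fst_add, Prod.snd_add, map_add, LinearMap.add_apply]; abel)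
    (fun c x y => by
      simp only [Prod.smul_fst, Prod.smul_snd, map_smul, LinearMap.smul_apply, smul_add, map_add,
        LinearMap.map_smul_of_tower])
    (fun x y y' => by
      simp only [Prod.fst_add, Prod.snd_add, map_add, LinearMap.add_apply]; abel)
    (fun c x y => by
      simp only [Prod.smul_fst, Prod.smul_snd, map_smul, LinearMap.smul_apply, smul_add, map_add,
        LinearMap.map_smul_of_tower])

theorem Representation.ev_semidirectBracket (ρ : Representation L M) (s : k) (x y : Q × M) :
    ev s (ρ.semidirectBracket x y) =
      (ev s (L.bracket x.1 y.1), ev s (ρ.l x.1 y.2) + evS s (ρ.r y.1 x.2)) := by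
  simp only [semidirectBracket, LinearMap.mk₂_apply, map_add, ev_mapRange, ev_skew]
  simp

end Scalars

/-! ## Dual representations and semidirect products -/

section Constructions

variable {k : Type*} [Field k] [CharZero k]
  {Q : Type*} [AddCommGroup Q] [Module k Q] [Module k[X] Q] [IsScalarTower k k[X] Q]
  {M : Type*} [AddCommGroup M] [Module k M] [Module k[X] M] [IsScalarTower k k[X] M]
  {L : LeibnizConformalAlgebra k Q}

/-- Elements of the dual are determined by the values of the pairing at scalars. -/
theorem cdual_ext {f g : CDual k M} (h : ∀ v (u : k), (pair f v).eval u = (pair g v).eval u) :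
    f = g :=
  CDual.ext fun v => Polynomial.funext (h v)

/-- The semidirect product Leibniz conformal algebra `Q ⋉_{l,r} M`. -/
def Representation.semidirect (ρ : Representation L M) : LeibnizConformalAlgebra k (Q × M) where
  bracket := ρ.semidirectBracket
  del_left x y := vpoly_ext (k := k) fun s => by
    rw [map_neg, ev_lam, ρ.ev_semidirectBracket, ρ.ev_semidirectBracket, del_prod]
    simp only [L.del_left, lin_map_del, Chom.del_apply, Chom.map_del, map_neg, ev_lam, evS_lam,
      LinearMap.add_apply, map_add, evS_del]
    ext
    · simp
    · simp; abel
  del_right x y := vpoly_ext (k := k) fun s => by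
    rw [LinearMap.add_apply, map_add, ev_lam, ev_del, ρ.ev_semidirectBracket,
      ρ.ev_semidirectBracket, del_prod, del_prod]
    simp only [L.del_right, lin_map_del, Chom.del_apply, Chom.map_del, map_neg, ev_lam, evS_lam,
      LinearMap.add_apply, map_add, ev_del]
    ext
    · simp
    · simp; abel
  jacobi x y z := vpoly₂_ext (k := k) fun s t => by
    rw [jacobi_left, jacobi_right]
    simp only [ρ.ev_semidirectBracket, L.jacobi_ev s t, Prod.mk_add_mk]
    congr 1
    have h1 := ρ.left_left_ev s t x.1 y.1 z.2
    have h2 := ρ.left_right_ev s t x.1 z.1 y.2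
    have h3 := ρ.left_right_ev t s y.1 z.1 x.2
    have h4 := ρ.right_right_ev t s y.1 z.1 x.2
    rw [add_comm t s] at h3 h4
    simp only [map_add]
    rw [h1, h2, h3, h4]
    abel

variable [Module.Finite k[X] M]

theorem pairAt_dual (g : Chom k M M) (f : CDual k M) (v : M) (s u : k) :
    pairAt (ev s (dualCend k M g f)) u v = -pairAt f (u - s) (ev s (g v)) :=
  pair_ev_dual g f v s u

/-- The right action `-l^* - r^*` of the dual representation. -/
def Representation.dualRight (ρ : Representation L M) :
    Q →ₗ[k[X]] Chom k (CDual k M) (CDual k M) :=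
  -(dualCend k M ∘ₗ ρ.l) - dualCend k M ∘ₗ ρ.r

theorem Representation.pairAt_dualRight (ρ : Representation L M) (b : Q) (f : CDual k M) (v : M)
    (s u : k) : pairAt (ev s (ρ.dualRight b f)) u v =
      pairAt f (u - s) (ev s (ρ.l b v)) + pairAt f (u - s) (ev s (ρ.r b v)) := by
  have : ρ.dualRight b f = -(dualCend k M (ρ.l b) f) + -(dualCend k M (ρ.r b) f) := by
    rw [← sub_eq_add_neg]; rfl
  rw [this, map_add, map_neg, map_neg, pairAt_add, pairAt_neg, pairAt_neg, pairAt_dual,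
    pairAt_dual, neg_neg, neg_neg]

/-- The dual representation `(M^{*c}, l^*, -l^* - r^*)`. -/
def Representation.dual (ρ : Representation L M) : Representation L (CDual k M) where
  l := dualCend k M ∘ₗ ρ.l
  r := ρ.dualRight
  left_left a b f := vpoly₂_ext (k := k) fun s t => cdual_ext fun v u => by
    rw [eval_ll, map_add, eval_bl, eval_ll', ← pairAt_apply, ← pairAt_apply, pairAt_add]
    simp only [LinearMap.comp_apply, pairAt_dual]
    have h := congrArg (pairAt f (u - s - t)) (ρ.left_left_ev s t a b v)
    rw [map_add] at h
    rw [show u - (s + t) = u - s - t by ring, show u - t - s = u - s - t by ring, h]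
    ring
  left_right a b f := vpoly₂_ext (k := k) fun s t => cdual_ext fun v u => by
    rw [eval_ll, map_add, eval_rl, eval_br, ev_skew, ← pairAt_apply, ← pairAt_apply, pairAt_add]
    simp only [LinearMap.comp_apply, pairAt_dual, pairAt_evS, Representation.pairAt_dualRight]
    rw [show u - s - (u - s - t) = t by ring, show u - (u - (s + t)) - s = t by ring,
      show u - (u - t) = t by ring, show u - (s + t) = u - s - t by ring]
    have h1 := congrArg (pairAt f t) (ρ.left_left_ev s (u - s - t) a b v)
    have h2 := ρ.pairAt_left_right f t s (u - s - t) a b v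
    rw [map_add, show s + (u - s - t) = u - t by ring] at h1
    rw [show s + (u - s - t) = u - t by ring] at h2
    rw [h1, h2]
    ring
  right_right a b f := vpoly₂_ext (k := k) fun s t => cdual_ext fun v u => by
    rw [eval_rr, map_neg, eval_rl, ev_skew, ← pairAt_apply, ← pairAt_apply, pairAt_neg]
    simp only [LinearMap.comp_apply, pairAt_dual, pairAt_evS, Representation.pairAt_dualRight]
    rw [show u - (u - (s + t)) - s = t by ring, show u - (u - (s + t)) - t = s by ring,
      show u - (u - (s + t)) - s = t by ring,
      ρ.pairAt_right_right f t (u - (s + t)) s b a v]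
    ring

end Constructions

/-! ## The isomorphism `M^{*c} ⊗ Q ≅ Chom(M, Q)` -/

section Eta

variable {k : Type*} [Field k]
  {M : Type*} [AddCommGroup M] [Module k M] [Module k[X] M] [IsScalarTower k k[X] M]
  {Q : Type*} [AddCommGroup Q] [Module k Q] [Module k[X] Q] [IsScalarTower k k[X] Q]

/-- `v ↦ ⟨f, v⟩_{λ+∂} a`, a conformal linear map `M → Q[λ]`. -/
def rankOne (f : CDual k M) (a : Q) : Chom k M Q :=
  ⟨{ toFun := fun v => Polynomial.aeval (lam k Q + del k (VPoly Q)) (pair f v) (const k Q a)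
     map_add' := fun v w => by simp only [map_add, LinearMap.add_apply]
     map_smul' := fun c v => by simp only [map_smul, LinearMap.smul_apply, RingHom.id_apply] },
   fun v => by
    change Polynomial.aeval (lam k Q + del k (VPoly Q)) (pair f (del k M v)) (const k Q a) = _
    rw [pair_del, map_mul, Polynomial.aeval_X]; rfl⟩

theorem rankOne_apply (f : CDual k M) (a : Q) (v : M) :
    rankOne f a v =
      Polynomial.aeval (lam k Q + del k (VPoly Q)) (pair f v) (const k Q a) := rfl

variable (k M Q) in
/-- `φ : M^{*c} ⊗ Q → Chom(M, Q)`, `φ(f ⊗ a)_λ v = ⟨f, v⟩_{λ+∂} a`, where `∂` acts on `Q`. -/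
def phi : CDual k M ⊗[k] Q →ₗ[k] Chom k M Q :=
  TensorProduct.lift (LinearMap.mk₂ k rankOne
    (fun f g a => Chom.ext fun v => by
      rw [map_add, LinearMap.add_apply, rankOne_apply, rankOne_apply, rankOne_apply, map_add,
        LinearMap.add_apply, map_add, LinearMap.add_apply])
    (fun c f a => Chom.ext fun v => by
      rw [map_smul, LinearMap.smul_apply, rankOne_apply, rankOne_apply, map_smul,
        LinearMap.smul_apply, map_smul, LinearMap.smul_apply])
    (fun f a b => Chom.ext fun v => by
      rw [map_add, LinearMap.add_apply, rankOne_apply, rankOne_apply, rankOne_apply, map_add,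
        map_add])
    (fun c f a => Chom.ext fun v => by
      rw [map_smul, LinearMap.smul_apply, rankOne_apply, rankOne_apply, map_smul, map_smul]))

theorem phi_tmul (f : CDual k M) (a : Q) (v : M) :
    phi k M Q (f ⊗ₜ a) v =
      Polynomial.aeval (lam k Q + del k (VPoly Q)) (pair f v) (const k Q a) := rfl

theorem map_aeval {W Z : Type*} [AddCommGroup W] [Module k W] [AddCommGroup Z] [Module k Z]
    (g : W →ₗ[k] Z) (D : Module.End k W) (D' : Module.End k Z) (h : ∀ w, g (D w) = D' (g w))
    (p : k[X]) (w : W) : g (Polynomial.aeval D p w) = Polynomial.aeval D' p (g w) := by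
  induction p using Polynomial.induction_on' with
  | add p q hp hq => simp only [map_add, LinearMap.add_apply, hp, hq]
  | monomial n c =>
    rw [← mul_one c, ← smul_eq_mul, ← Polynomial.smul_monomial, ← Polynomial.X_pow_eq_monomial,
      map_smul, map_smul, LinearMap.smul_apply, LinearMap.smul_apply, map_smul]
    congr 1
    induction n generalizing w with
    | zero => simp
    | succ n ih =>
      rw [pow_succ, map_mul, map_mul, Polynomial.aeval_X, Polynomial.aeval_X,
        Module.End.mul_apply, Module.End.mul_apply, ih, h]

theorem aeval_del (p : k[X]) (v : M) : Polynomial.aeval (del k M) p v = p • v := by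
  induction p using Polynomial.induction_on' with
  | add p q hp hq => simp only [map_add, LinearMap.add_apply, hp, hq, add_smul]
  | monomial n c =>
    rw [← mul_one c, ← smul_eq_mul, ← Polynomial.smul_monomial, ← Polynomial.X_pow_eq_monomial,
      map_smul, LinearMap.smul_apply, smul_assoc]
    congr 1
    induction n generalizing v with
    | zero => simp
    | succ n ih =>
      rw [pow_succ, map_mul, Polynomial.aeval_X, Module.End.mul_apply, ih, mul_smul]
      rfl

/-- A conformal linear map is determined by its values on a `k[∂]`-basis. -/
theorem Chom.ext_basis {ι : Type*} (b : Module.Basis ι k[X] M) {S T : Chom k M Q}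
    (h : ∀ i, S (b i) = T (b i)) : S = T := by
  refine Chom.ext fun v => ?_
  have hv : v ∈ Submodule.span k[X] (Set.range b) := b.span_eq ▸ Submodule.mem_top
  induction hv using Submodule.span_induction with
  | mem x hx => obtain ⟨i, rfl⟩ := hx; exact h i
  | zero => simp
  | add x y _ _ hx hy => simp only [map_add, hx, hy]
  | smul p x _ hx =>
    rw [← aeval_del, map_aeval S.toLin _ _ S.map_del, map_aeval T.toLin _ _ T.map_del, hx]

/-- The dual basis element `v_i^*`. -/
def dualBasis {ι : Type*} (b : Module.Basis ι k[X] M) (i : ι) : CDual k M :=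
  CDual.mk ((b.coord i).restrictScalars k) fun v => (b.coord i).map_smul Polynomial.X v

variable (k M Q) in
/-- `-∂ ⊗ 1 - 1 ⊗ ∂` on `M^{*c} ⊗ Q`. -/
def negDel₂ : Module.End k (CDual k M ⊗[k] Q) :=
  -(LinearMap.rTensor Q (del k (CDual k M)) + LinearMap.lTensor (CDual k M) (del k Q))

/-- The candidate inverse of `φ` in terms of a basis. -/
def psi {ι : Type*} [Fintype ι] (b : Module.Basis ι k[X] M) :
    Chom k M Q →ₗ[k] CDual k M ⊗[k] Q :=
  ∑ i, subst (negDel₂ k M Q) (TensorProduct.mk k (CDual k M) Q (dualBasis b i)) ∘ₗ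
    Chom.toLin.flip (b i)

theorem pair_dualBasis {ι : Type*} [DecidableEq ι] (b : Module.Basis ι k[X] M) (i j : ι) :
    pair (dualBasis b i) (b j) = if i = j then 1 else 0 := by
  change b.repr (b j) i = _
  rw [b.repr_self, Finsupp.single_apply]
  simp only [eq_comm]

theorem phi_negDel₂ (e : CDual k M ⊗[k] Q) (v : M) :
    phi k M Q (negDel₂ k M Q e) v = lam k Q (phi k M Q e v) := by
  induction e using TensorProduct.induction_on with
  | zero => simp
  | add x y hx hy => simp only [map_add, LinearMap.add_apply, hx, hy]
  | tmul f a =>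
    rw [negDel₂, LinearMap.neg_apply, LinearMap.add_apply, LinearMap.rTensor_tmul,
      LinearMap.lTensor_tmul, map_neg, map_add, map_neg, map_add, LinearMap.neg_apply,
      LinearMap.add_apply, phi_tmul, phi_tmul, phi_tmul, pair_del_left, map_neg,
      LinearMap.neg_apply, map_mul, Polynomial.aeval_X, Module.End.mul_apply]
    have hc : const k Q (del k Q a) = del k (VPoly Q) (const k Q a) := by
      simp [const, del]
    rw [hc, ← map_aeval (del k (VPoly Q)) (lam k Q + del k (VPoly Q)) _
      (fun w => by simp [lam_comm_del]), LinearMap.add_apply]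
    abel

theorem phi_psi {ι : Type*} [Fintype ι] (b : Module.Basis ι k[X] M) (T : Chom k M Q) :
    phi k M Q (psi b T) = T := by
  classical
  refine Chom.ext_basis b fun j => ?_
  have h1 : ∀ (i : ι) (p : VPoly Q), phi k M Q (subst (negDel₂ k M Q)
      (TensorProduct.mk k (CDual k M) Q (dualBasis b i)) p) (b j) = if i = j then p else 0 := by
    intro i p
    have := map_subst (Chom.toLin.flip (b j) ∘ₗ phi k M Q) (negDel₂ k M Q) (lam k Q)
      (fun e => phi_negDel₂ e (b j)) (TensorProduct.mk k (CDual k M) Q (dualBasis b i)) p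
    refine this.trans ?_
    clear this
    induction p using Finsupp.induction_linear with
    | zero => simp
    | add p q hp hq => rw [map_add, hp, hq]; split_ifs <;> simp
    | single n v =>
      rw [subst_single]
      have : (Chom.toLin.flip (b j) ∘ₗ phi k M Q) ((TensorProduct.mk k (CDual k M) Q
          (dualBasis b i)) v) = if i = j then const k Q v else 0 := by
        change phi k M Q (dualBasis b i ⊗ₜ v) (b j) = _
        rw [phi_tmul, pair_dualBasis]
        split_ifs <;> simp
      rw [LinearMap.comp_apply, this]
      split_ifs
      · induction n with
        | zero => simp [const]
        | succ n ih => rw [pow_succ', Module.End.mul_apply, ih, lam_single]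
      · simp
  simp only [psi, LinearMap.sum_apply, LinearMap.comp_apply, map_sum, LinearMap.flip_apply, h1]
  simp

theorem psi_phi {ι : Type*} [Fintype ι] (b : Module.Basis ι k[X] M) (e : CDual k M ⊗[k] Q) :
    psi b (phi k M Q e) = e := by
  classical
  induction e using TensorProduct.induction_on with
  | zero => simp
  | add x y hx hy => simp only [map_add, hx, hy]
  | tmul f a =>
    have h1 : ∀ (i : ι) (q : VPoly Q),
        subst (negDel₂ k M Q) (TensorProduct.mk k (CDual k M) Q (dualBasis b i))
          ((lam k Q + del k (VPoly Q)) q) =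
        (-LinearMap.rTensor Q (del k (CDual k M)))
          (subst (negDel₂ k M Q) (TensorProduct.mk k (CDual k M) Q (dualBasis b i)) q) := by
      intro i q
      have hd : subst (negDel₂ k M Q) (TensorProduct.mk k (CDual k M) Q (dualBasis b i))
          (del k (VPoly Q) q) = LinearMap.lTensor (CDual k M) (del k Q)
          (subst (negDel₂ k M Q) (TensorProduct.mk k (CDual k M) Q (dualBasis b i)) q) := by
        rw [map_subst (LinearMap.lTensor (CDual k M) (del k Q)) (negDel₂ k M Q) (negDel₂ k M Q),
          del_eq_mapRange]
        · induction q using Finsupp.induction_linear with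
          | zero => simp
          | add p q hp hq => simp only [map_add, hp, hq]
          | single n v => simp [subst_single]
        · intro w
          induction w using TensorProduct.induction_on with
          | zero => simp
          | add x y hx hy => simp only [map_add, hx, hy]
          | tmul f a => simp [negDel₂]
      rw [LinearMap.add_apply, map_add, hd, subst_lam, negDel₂]
      simp only [LinearMap.neg_apply, LinearMap.add_apply]
      abel
    have h2 : ∀ (p : k[X]) (g : CDual k M),
        Polynomial.aeval (-LinearMap.rTensor Q (del k (CDual k M))) p (g ⊗ₜ[k] a) =
          (Polynomial.aeval (-del k (CDual k M)) p g) ⊗ₜ[k] a := fun p g =>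
      (map_aeval ((TensorProduct.mk k (CDual k M) Q).flip a) (-del k (CDual k M))
        (-LinearMap.rTensor Q (del k (CDual k M)))
        (fun w => by simp) p g).symm
    have h3 : ∀ (p : k[X]) (g : CDual k M) (v : M),
        pair (Polynomial.aeval (-del k (CDual k M)) p g) v = p * pair g v := by
      intro p g v
      refine (map_aeval (pair.flip v) (-del k (CDual k M)) (LinearMap.mulLeft k Polynomial.X)
        (fun w => by simp [pair_del_left]) p g).trans ?_
      rw [LinearMap.flip_apply]
      have : (LinearMap.mulLeft k (Polynomial.X : k[X])) = del k k[X] := rfl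
      rw [this, aeval_del, smul_eq_mul]
    have h4 : ∑ i, Polynomial.aeval (-del k (CDual k M)) (pair f (b i)) (dualBasis b i) = f := by
      have h5 : ∀ g : CDual k M, ∀ (p : k[X]) (v : M), pair g (p • v) = p * pair g v := by
        intro g p v
        rw [← aeval_del, map_aeval (pair g) _ (del k k[X]) (pair_del g), aeval_del, smul_eq_mul]
      refine CDual.ext fun v => ?_
      have hv : v ∈ Submodule.span k[X] (Set.range b) := b.span_eq ▸ Submodule.mem_top
      induction hv using Submodule.span_induction with
      | mem x hx =>
        obtain ⟨j, rfl⟩ := hx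
        simp [h3, pair_dualBasis]
      | zero => simp
      | add x y _ _ hx hy => rw [map_add, map_add, hx, hy]
      | smul p x _ hx => rw [h5, h5, hx]
    conv_rhs => rw [← h4, TensorProduct.sum_tmul]
    rw [psi, LinearMap.sum_apply]
    refine Finset.sum_congr rfl fun i _ => ?_
    rw [LinearMap.comp_apply, LinearMap.flip_apply, phi_tmul, map_aeval _ _ _ (h1 i), ← h2]
    congr 1
    simp [const, subst_single]

variable (k M Q) in
theorem phi_bijective [Module.Finite k[X] M] [Module.Free k[X] M] :
    Function.Bijective (phi k M Q) :=
  Function.bijective_iff_has_inverse.mpr ⟨psi (Module.Free.chooseBasis k[X] M),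
    psi_phi _, phi_psi _⟩

variable (k M Q) in
/-- `η : Chom(M, Q) → M^{*c} ⊗ Q`, the inverse of `φ`. -/
def eta [Module.Finite k[X] M] [Module.Free k[X] M] : Chom k M Q ≃ₗ[k] CDual k M ⊗[k] Q :=
  (LinearEquiv.ofBijective (phi k M Q) (phi_bijective k M Q)).symm

end Eta

/-! ## The classical Leibniz conformal Yang-Baxter equation -/

section YangBaxter

variable {k : Type*} [Field k]
  {P : Type*} [AddCommGroup P] [Module k P] [Module k[X] P] [IsScalarTower k k[X] P]

variable (k P) in
/-- `∂_1 = ∂ ⊗ 1 ⊗ 1`. -/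
def del₁ : Module.End k (P ⊗[k] P ⊗[k] P) :=
  LinearMap.rTensor P (LinearMap.rTensor P (del k P))

variable (k P) in
/-- `∂_2 = 1 ⊗ ∂ ⊗ 1`. -/
def del₂ : Module.End k (P ⊗[k] P ⊗[k] P) :=
  LinearMap.rTensor P (LinearMap.lTensor P (del k P))

variable (k P) in
/-- `∂_3 = 1 ⊗ 1 ⊗ ∂`. -/
def del₃ : Module.End k (P ⊗[k] P ⊗[k] P) :=
  LinearMap.lTensor (P ⊗[k] P) (del k P)

/-- For a linear map `ω` on `P ⊗ (P ⊗ P)`, the map `p ⊗ y ⊗ z ↦ ω(p, y, z)|_{μ = D}`,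
where `p ∈ P[μ]`. -/
def substAt (D : Module.End k (P ⊗[k] P ⊗[k] P))
    (ω : P ⊗[k] (P ⊗[k] P) →ₗ[k] P ⊗[k] P ⊗[k] P) :
    VPoly P ⊗[k] (P ⊗[k] P) →ₗ[k] P ⊗[k] P ⊗[k] P :=
  TensorProduct.lift (Finsupp.lsum k fun n => (TensorProduct.curry ω).compr₂ (D ^ n))

/-- `a ⊗ b ⊗ c ⊗ d ↦ ω([a_μ b], c, d)|_{μ = D}`. -/
def bracketAt (L : LeibnizConformalAlgebra k P) (D : Module.End k (P ⊗[k] P ⊗[k] P))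
    (ω : P ⊗[k] (P ⊗[k] P) →ₗ[k] P ⊗[k] P ⊗[k] P) :
    (P ⊗[k] P) ⊗[k] (P ⊗[k] P) →ₗ[k] P ⊗[k] P ⊗[k] P :=
  substAt D ω ∘ₗ LinearMap.rTensor (P ⊗[k] P) (TensorProduct.lift L.bracket)

variable (k P) in
/-- `x ⊗ (y ⊗ z) ↦ x ⊗ y ⊗ z`. -/
def slot₁ : P ⊗[k] (P ⊗[k] P) →ₗ[k] P ⊗[k] P ⊗[k] P :=
  (TensorProduct.assoc k P P P).symm.toLinearMap

variable (k P) in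
/-- `x ⊗ (y ⊗ z) ↦ y ⊗ x ⊗ z`. -/
def slot₂ : P ⊗[k] (P ⊗[k] P) →ₗ[k] P ⊗[k] P ⊗[k] P :=
  LinearMap.rTensor P (TensorProduct.comm k P P).toLinearMap ∘ₗ slot₁ k P

variable (k P) in
/-- `x ⊗ (y ⊗ z) ↦ y ⊗ z ⊗ x`. -/
def slot₃ : P ⊗[k] (P ⊗[k] P) →ₗ[k] P ⊗[k] P ⊗[k] P :=
  (TensorProduct.comm k P (P ⊗[k] P)).toLinearMap

variable (k P) in
/-- `(a ⊗ b) ⊗ (c ⊗ d) ↦ (a ⊗ c) ⊗ (b ⊗ d)`. -/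
def swapMid : (P ⊗[k] P) ⊗[k] (P ⊗[k] P) →ₗ[k] (P ⊗[k] P) ⊗[k] (P ⊗[k] P) :=
  (TensorProduct.tensorTensorTensorComm k P P P P).toLinearMap

variable (k P) in
/-- `(a ⊗ b) ⊗ e ↦ (b ⊗ a) ⊗ e`. -/
def swapFst : (P ⊗[k] P) ⊗[k] (P ⊗[k] P) →ₗ[k] (P ⊗[k] P) ⊗[k] (P ⊗[k] P) :=
  LinearMap.rTensor (P ⊗[k] P) (TensorProduct.comm k P P).toLinearMap

/-- For `r = ∑ a_i ⊗ b_i`, the element `[[r, r]]` of `P ⊗ P ⊗ P`: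
`∑ [a_i_μ a_j] ⊗ b_i ⊗ b_j |_{μ = ∂_2} + ∑ a_i ⊗ a_j ⊗ [b_j_μ b_i] |_{μ = ∂_2}
- ∑ a_i ⊗ [b_i_μ a_j] ⊗ b_j |_{μ = ∂_1} - ∑ a_i ⊗ [a_j_μ b_i] ⊗ b_j |_{μ = -∂_1-∂_2}`. -/
def yangBaxter (L : LeibnizConformalAlgebra k P) (r : P ⊗[k] P) : P ⊗[k] P ⊗[k] P :=
  bracketAt L (del₂ k P) (slot₁ k P) (swapMid k P (r ⊗ₜ r)) +
    bracketAt L (del₂ k P) (slot₃ k P)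
      (swapFst k P (TensorProduct.comm k _ _ (swapMid k P (r ⊗ₜ r)))) -
    bracketAt L (del₁ k P) (slot₂ k P) (swapMid k P (swapFst k P (r ⊗ₜ r))) -
    bracketAt L (-del₁ k P - del₂ k P) (slot₂ k P)
      (swapFst k P (swapMid k P (swapFst k P (r ⊗ₜ r))))

theorem bracketAt_tmul (L : LeibnizConformalAlgebra k P) (D : Module.End k (P ⊗[k] P ⊗[k] P))
    (ω : P ⊗[k] (P ⊗[k] P) →ₗ[k] P ⊗[k] P ⊗[k] P) (a b c d : P) :
    bracketAt L D ω ((a ⊗ₜ b) ⊗ₜ (c ⊗ₜ d)) =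
      (L.bracket a b).sum fun n x => (D ^ n) (ω (x ⊗ₜ (c ⊗ₜ d))) := by
  rw [bracketAt, LinearMap.comp_apply, LinearMap.rTensor_tmul, TensorProduct.lift.tmul, substAt,
    TensorProduct.lift.tmul]
  generalize L.bracket a b = p
  induction p using Finsupp.induction_linear with
  | zero => simp
  | add p q hp hq =>
    rw [map_add, LinearMap.add_apply, hp, hq, Finsupp.sum_add_index']
    · simp
    · intro n x y; rw [TensorProduct.add_tmul, map_add, map_add]
  | single n v => simp

/-- `[[r, r]]` for `r` given as a sum of pure tensors. -/
theorem yangBaxter_sum (L : LeibnizConformalAlgebra k P) {ι : Type*} (s : Finset ι)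
    (a b : ι → P) :
    yangBaxter L (∑ i ∈ s, a i ⊗ₜ[k] b i) = ∑ i ∈ s, ∑ j ∈ s,
      (((L.bracket (a i) (a j)).sum fun n x => (del₂ k P ^ n) (x ⊗ₜ[k] b i ⊗ₜ[k] b j)) +
        ((L.bracket (b j) (b i)).sum fun n x => (del₂ k P ^ n) (a i ⊗ₜ[k] a j ⊗ₜ[k] x)) -
        ((L.bracket (b i) (a j)).sum fun n x => (del₁ k P ^ n) (a i ⊗ₜ[k] x ⊗ₜ[k] b j)) -
        ((L.bracket (a j) (b i)).sum fun n x =>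
          ((-del₁ k P - del₂ k P) ^ n) (a i ⊗ₜ[k] x ⊗ₜ[k] b j))) := by
  have h : (∑ i ∈ s, a i ⊗ₜ[k] b i) ⊗ₜ[k] (∑ i ∈ s, a i ⊗ₜ[k] b i) =
      ∑ i ∈ s, ∑ j ∈ s, (a i ⊗ₜ[k] b i) ⊗ₜ[k] (a j ⊗ₜ[k] b j) := by
    rw [TensorProduct.sum_tmul]
    simp only [TensorProduct.tmul_sum]
  rw [yangBaxter, h]
  simp only [map_sum, ← Finset.sum_sub_distrib, ← Finset.sum_add_distrib]
  refine Finset.sum_congr rfl fun i _ => Finset.sum_congr rfl fun j _ => ?_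
  simp only [swapMid, swapFst, slot₁, slot₂, slot₃, LinearEquiv.coe_coe, LinearMap.comp_apply,
    TensorProduct.tensorTensorTensorComm_tmul, TensorProduct.comm_tmul, LinearMap.rTensor_tmul,
    bracketAt_tmul, TensorProduct.assoc_symm_tmul]

/-- `r` is a solution of the CLCYBE: `[[r, r]] = 0` modulo the image of `∂_1 + ∂_2 + ∂_3`. -/
def IsCLCYBESolution (L : LeibnizConformalAlgebra k P) (r : P ⊗[k] P) : Prop :=
  yangBaxter L r ∈ LinearMap.range (del₁ k P + del₂ k P + del₃ k P)

/-- The flip `τ(a ⊗ b) = b ⊗ a`. -/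
def tau : P ⊗[k] P →ₗ[k] P ⊗[k] P := (TensorProduct.comm k P P).toLinearMap

/-- A symmetric solution of the CLCYBE. -/
def IsSymmetricSolution (L : LeibnizConformalAlgebra k P) (r : P ⊗[k] P) : Prop :=
  tau r = r ∧ IsCLCYBESolution L r

end YangBaxter

/-! ## `𝒪`-operators -/

section OOperator

variable {k : Type*} [Field k]
  {Q : Type*} [AddCommGroup Q] [Module k Q] [Module k[X] Q] [IsScalarTower k k[X] Q]
  {M : Type*} [AddCommGroup M] [Module k M] [Module k[X] M] [IsScalarTower k k[X] M]
  {L : LeibnizConformalAlgebra k Q}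

/-- A `k[∂]`-module homomorphism `T : M → Q` is an `𝒪`-operator associated to `(M, l, r)` if
`[T(x)_λ T(y)] = T(l(T(x))_λ y + r(T(y))_{-λ-∂} x)` in `Q[λ]`, with `T` applied to
coefficients on the right. -/
def IsOOperator (ρ : Representation L M) (T : M →ₗ[k[X]] Q) : Prop :=
  ∀ x y : M, L.bracket (T x) (T y) =
    Finsupp.mapRange.linearMap (T.restrictScalars k)
      (ρ.l (T x) y + skew k M (ρ.r (T y) x))

variable (k Q M) in
/-- The inclusion `M^{*c} ⊗ Q ⊆ (Q ⊕ M^{*c}) ⊗ (Q ⊕ M^{*c})`. -/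
def inclTensor : CDual k M ⊗[k] Q →ₗ[k] (Q × CDual k M) ⊗[k] (Q × CDual k M) :=
  TensorProduct.map (LinearMap.inr k Q (CDual k M)) (LinearMap.inl k Q (CDual k M))

end OOperator

end

end LeibnizConformal

/-! Everything is tested on characters: functionals `χ` on a `k[∂]`-module with `χ(∂p) = s χ(p)` for
a scalar `s`, the weight. Such a `χ` turns a polynomial in `∂` into its value at `s`, so the
substitutions `μ = ∂₂`, `λ ↦ -λ - ∂` and the like become scalar arithmetic. A field of
characteristic zero is infinite, so polynomial identities may be checked at scalars.

For weights `s + t + u = 0`, the functional `χ₁ ⊗ χ₂ ⊗ χ₃` kills the image of `∂₁ + ∂₂ + ∂₃`.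
Conversely, when `P` has a finite dual family, these triples detect membership in that image
(`mem_range_of_triple`): modulo the image `∂₂` can be eliminated, and what remains is a family of
polynomials determined by its values. The CLCYBE thus becomes a system of scalar equations.

For symmetric `r`, each such value of `[[r, r]]` is a signed sum of four values of brackets of
contractions of `r` (`triple_yangBaxter`). A character of `Q ⊕ M^{*c}` is built from a pair `(φ, x)`
with `φ ∈ Q^{*c}` and `x ∈ M`. Contracting `r = e + τ e` with it at weight `u` gives an element
whose `Q`-part is indistinguishable from `S(x)` for functionals of weight `-u`, where `S = φ(e)_0`,
and whose `M^{*c}`-part pairs with `v` at `u` to give `⟨φ, S v⟩_u`. Hence the bracket of two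
contractions is expressed through `S`, `l` and `r` alone (`pairAt_bracket_contractLeft`).

In the resulting sum the superfluous `l`-terms cancel, leaving four values of the defect of the
`𝒪`-operator identity (`triple_yangBaxter_symTensor`). If the identity holds, all of them vanish. If
the equation holds, choosing two of the three `φ`'s to be zero isolates one arbitrary defect. -/

namespace LeibnizConformal

set_option linter.unusedSectionVars false

noncomputable section

/-! ### Characters on triple tensors, and detection of the image of `∂₁ + ∂₂ + ∂₃`. -/

section Characters

variable {k : Type*} [Field k]
  {P : Type*} [AddCommGroup P] [Module k P] [Module k[X] P] [IsScalarTower k k[X] P]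

/-- The functional `χ₁ ⊗ χ₂ ⊗ χ₃` on `P ⊗ P ⊗ P`. -/
def triple (χ₁ χ₂ χ₃ : P →ₗ[k] k) : P ⊗[k] P ⊗[k] P →ₗ[k] k :=
  LinearMap.mul' k k ∘ₗ TensorProduct.map (LinearMap.mul' k k ∘ₗ TensorProduct.map χ₁ χ₂) χ₃

theorem triple_tmul (χ₁ χ₂ χ₃ : P →ₗ[k] k) (p q r : P) :
    triple χ₁ χ₂ χ₃ (p ⊗ₜ q ⊗ₜ r) = χ₁ p * χ₂ q * χ₃ r := rfl

variable {χ₁ χ₂ χ₃ : P →ₗ[k] k} {s t u : k}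

theorem triple_del₁ (h : ∀ p, χ₁ (del k P p) = s • χ₁ p) (w : P ⊗[k] P ⊗[k] P) :
    triple χ₁ χ₂ χ₃ (del₁ k P w) = s • triple χ₁ χ₂ χ₃ w := by
  suffices H : triple χ₁ χ₂ χ₃ ∘ₗ del₁ k P = s • triple χ₁ χ₂ χ₃ from LinearMap.congr_fun H w
  ext p q r
  simp [del₁, triple_tmul, h]
  ring

theorem triple_del₂ (h : ∀ p, χ₂ (del k P p) = t • χ₂ p) (w : P ⊗[k] P ⊗[k] P) :
    triple χ₁ χ₂ χ₃ (del₂ k P w) = t • triple χ₁ χ₂ χ₃ w := by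
  suffices H : triple χ₁ χ₂ χ₃ ∘ₗ del₂ k P = t • triple χ₁ χ₂ χ₃ from LinearMap.congr_fun H w
  ext p q r
  simp [del₂, triple_tmul, h]
  ring

theorem triple_del₃ (h : ∀ p, χ₃ (del k P p) = u • χ₃ p) (w : P ⊗[k] P ⊗[k] P) :
    triple χ₁ χ₂ χ₃ (del₃ k P w) = u • triple χ₁ χ₂ χ₃ w := by
  suffices H : triple χ₁ χ₂ χ₃ ∘ₗ del₃ k P = u • triple χ₁ χ₂ χ₃ from LinearMap.congr_fun H w
  ext p q r
  simp [del₃, triple_tmul, h]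
  ring

/-- Triples of characters of total weight zero vanish on the image of `∂_1 + ∂_2 + ∂_3`. -/
theorem triple_eq_zero_of_mem_range (h₁ : ∀ p, χ₁ (del k P p) = s • χ₁ p)
    (h₂ : ∀ p, χ₂ (del k P p) = t • χ₂ p) (h₃ : ∀ p, χ₃ (del k P p) = u • χ₃ p)
    (hu : s + t + u = 0) {w : P ⊗[k] P ⊗[k] P}
    (hw : w ∈ LinearMap.range (del₁ k P + del₂ k P + del₃ k P)) :
    triple χ₁ χ₂ χ₃ w = 0 := by
  obtain ⟨z, rfl⟩ := hw
  rw [LinearMap.add_apply, LinearMap.add_apply, map_add, map_add, triple_del₁ h₁, triple_del₂ h₂,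
    triple_del₃ h₃, ← add_smul, ← add_smul, hu, zero_smul]

/-- `p ⊗ q ⊗ r ↦ ⟨c, p⟩_λ ⟨d, q⟩_{-λ-∂} r`. -/
def toVPoly (c d : CDual k P) : P ⊗[k] P ⊗[k] P →ₗ[k] VPoly P :=
  TensorProduct.lift (LinearMap.lcomp k (VPoly P) (const k P) ∘ₗ
    LinearMap.mul' k (Module.End k (VPoly P)) ∘ₗ
      TensorProduct.map ((Polynomial.aeval (lam k P)).toLinearMap ∘ₗ pair c)
        ((Polynomial.aeval (-lam k P - del k (VPoly P))).toLinearMap ∘ₗ pair d))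

theorem toVPoly_tmul (c d : CDual k P) (p q r : P) :
    toVPoly c d (p ⊗ₜ q ⊗ₜ r) = Polynomial.aeval (lam k P) (pair c p)
      (Polynomial.aeval (-lam k P - del k (VPoly P)) (pair d q) (const k P r)) := rfl

theorem aeval_smul_one {W : Type*} [AddCommGroup W] [Module k W] (s : k) (p : k[X]) (w : W) :
    Polynomial.aeval (s • (1 : Module.End k W)) p w = p.eval s • w := by
  induction p using Polynomial.induction_on' with
  | add p q hp hq => simp only [map_add, LinearMap.add_apply, hp, hq, Polynomial.eval_add, add_smul]
  | monomial n c => simp [Polynomial.aeval_monomial, smul_pow, smul_smul, mul_comm]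

/-- A functional on which `D` acts by a scalar turns polynomials in `D` into their values. -/
theorem functional_aeval {W Z : Type*} [AddCommGroup W] [Module k W] [AddCommGroup Z] [Module k Z]
    (ψ : W →ₗ[k] Z) (D : Module.End k W) (s : k) (h : ∀ w, ψ (D w) = s • ψ w) (p : k[X]) (w : W) :
    ψ (Polynomial.aeval D p w) = p.eval s • ψ w := by
  rw [map_aeval ψ D (s • 1) (by simpa using h), aeval_smul_one]

/-- Evaluating `λ` at `s` and pairing at `u` makes `-λ - ∂` the scalar `-s - u`, which is the second
weight needed for a total of zero. The polynomials `toVPoly c d w` therefore carry the same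
information as the weight-zero triples. -/
theorem pairAt_toVPoly (c d e : CDual k P) (s u : k) (w : P ⊗[k] P ⊗[k] P) :
    pairAt e u (ev s (toVPoly c d w)) =
      triple (pairAt c s) (pairAt d (-s - u)) (pairAt e u) w := by
  suffices H : pairAt e u ∘ₗ ev s ∘ₗ toVPoly c d =
      triple (pairAt c s) (pairAt d (-s - u)) (pairAt e u) from LinearMap.congr_fun H w
  ext p q r
  simp only [TensorProduct.AlgebraTensorModule.curry_apply, TensorProduct.curry_apply,
    LinearMap.restrictScalars_apply, LinearMap.comp_apply, toVPoly_tmul, triple_tmul]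
  -- The composite functional has weight `s` for multiplication by `λ` and weight `-s - u` for `-λ -
  -- ∂`.
  have h₁ := functional_aeval (pairAt e u ∘ₗ ev s) (lam k P) s (fun w => by simp [ev_lam])
    (pair c p) (Polynomial.aeval (-lam k P - del k (VPoly P)) (pair d q) (const k P r))
  have h₂ := functional_aeval (pairAt e u ∘ₗ ev s) (-lam k P - del k (VPoly P)) (-s - u)
    (fun w => by simp [ev_lam, ev_del, pairAt_del]; ring) (pair d q) (const k P r)
  rw [h₂] at h₁
  simp only [LinearMap.comp_apply, ev_const] at h₁
  rw [h₁, pairAt_apply c, pairAt_apply d, smul_eq_mul, smul_eq_mul, mul_assoc]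

theorem del₁_tmul (p q r : P) : del₁ k P (p ⊗ₜ q ⊗ₜ r) = del k P p ⊗ₜ q ⊗ₜ r := rfl

theorem del₂_tmul (p q r : P) : del₂ k P (p ⊗ₜ q ⊗ₜ r) = p ⊗ₜ del k P q ⊗ₜ r := rfl

theorem del₃_tmul (p q r : P) : del₃ k P (p ⊗ₜ q ⊗ₜ r) = p ⊗ₜ q ⊗ₜ del k P r := rfl

theorem commute_del₁_del₂ : Commute (del₁ k P) (del₂ k P) :=
  TensorProduct.ext_threefold fun p q r => by simp [del₁_tmul, del₂_tmul]

theorem commute_del₁_del₃ : Commute (del₁ k P) (del₃ k P) :=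
  TensorProduct.ext_threefold fun p q r => by simp [del₁_tmul, del₃_tmul]

theorem commute_del₂_del₃ : Commute (del₂ k P) (del₃ k P) :=
  TensorProduct.ext_threefold fun p q r => by simp [del₂_tmul, del₃_tmul]

/-- Commuting elements satisfy `x - y ∣ F(x) - F(y)`. -/
theorem sub_dvd_aeval_sub {A : Type*} [Ring A] [Algebra k A] {x y : A} (h : Commute x y)
    (F : k[X]) : x - y ∣ Polynomial.aeval x F - Polynomial.aeval y F := by
  induction F using Polynomial.induction_on' with
  | add p q hp hq => simpa only [map_add, add_sub_add_comm] using dvd_add hp hq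
  | monomial n c =>
    obtain ⟨z, hz⟩ := h.sub_dvd_pow_sub_pow n
    exact ⟨c • z, by
      simp only [Polynomial.aeval_monomial, ← Algebra.smul_def, mul_smul_comm, ← smul_sub, hz]⟩

/-- Modulo the image, `∂₂` may be replaced by `-∂₁ - ∂₃` inside any polynomial: these operators
commute, and their difference `∂₁ + ∂₂ + ∂₃` divides the difference of the two values of `F`. -/
theorem aeval_sub_mem_range (F : k[X]) (w : P ⊗[k] P ⊗[k] P) :
    Polynomial.aeval (del₂ k P) F w - Polynomial.aeval (-del₁ k P - del₃ k P) F w ∈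
      LinearMap.range (del₁ k P + del₂ k P + del₃ k P) := by
  have hc : Commute (del₂ k P) (-del₁ k P - del₃ k P) := LinearMap.ext fun z => by
    have h₁ := LinearMap.congr_fun (commute_del₁_del₂ (k := k) (P := P)).eq z
    have h₃ := LinearMap.congr_fun (commute_del₂_del₃ (k := k) (P := P)).eq z
    simp only [Module.End.mul_apply] at h₁ h₃
    simp only [Module.End.mul_apply, LinearMap.sub_apply, LinearMap.neg_apply, map_sub, map_neg,
      h₁, h₃]
  obtain ⟨z, hz⟩ := sub_dvd_aeval_sub (A := Module.End k (P ⊗[k] P ⊗[k] P)) hc F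
  refine ⟨z w, ?_⟩
  rw [← LinearMap.sub_apply, hz, Module.End.mul_apply]
  congr 1
  abel

/-- `∑ λ ^ n r_n ↦ ∑ ∂ ^ n a ⊗ b ⊗ r_n`. -/
def ofVPoly (a b : P) : VPoly P →ₗ[k] P ⊗[k] P ⊗[k] P :=
  subst (del₁ k P) (TensorProduct.mk k (P ⊗[k] P) P (a ⊗ₜ b))

theorem ofVPoly_lam (a b : P) (p : VPoly P) :
    ofVPoly a b (lam k P p) = del₁ k P (ofVPoly a b p) := subst_lam _ _ p

theorem ofVPoly_del (a b : P) (p : VPoly P) :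
    ofVPoly a b (del k (VPoly P) p) = del₃ k P (ofVPoly a b p) := by
  rw [ofVPoly, map_subst (del₃ k P) (del₁ k P) (del₁ k P)
    (fun w => (LinearMap.congr_fun (commute_del₁_del₃ (k := k) (P := P)).eq w).symm), del_eq_mapRange]
  induction p using Finsupp.induction_linear with
  | zero => simp
  | add p q hp hq => simp only [map_add, hp, hq]
  | single n v => simp [subst_single, del₃_tmul]

theorem ofVPoly_const (a b r : P) : ofVPoly (k := k) a b (const k P r) = a ⊗ₜ b ⊗ₜ r := by
  simp [ofVPoly, const, subst_single]

/-- The first term is `c(∂₁) d(∂₂)` applied to `a ⊗ b ⊗ r`, with `c`, `d` short for the two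
pairings. The second is `c(∂₁) d(-∂₁ - ∂₃)` applied to the same tensor, because `ofVPoly` carries
`λ` to `∂₁` and `∂` to `∂₃`. They agree once `∂₂` is eliminated. -/
theorem ofVPoly_toVPoly (a b : P) (c d : CDual k P) (p q r : P) :
    (pair c p • a) ⊗ₜ[k] (pair d q • b) ⊗ₜ[k] r - ofVPoly a b (toVPoly c d (p ⊗ₜ q ⊗ₜ r)) ∈
      LinearMap.range (del₁ k P + del₂ k P + del₃ k P) := by
  have h₁ : ∀ (F : k[X]) (a b : P), Polynomial.aeval (del₁ k P) F (a ⊗ₜ b ⊗ₜ r) =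
      (F • a) ⊗ₜ b ⊗ₜ r := fun F a b => by
    rw [← aeval_del]
    exact (map_aeval ((TensorProduct.mk k (P ⊗[k] P) P).flip r ∘ₗ (TensorProduct.mk k P P).flip b)
      (del k P) (del₁ k P) (fun _ => rfl) F a).symm
  have h₂ : ∀ (F : k[X]) (a b : P), Polynomial.aeval (del₂ k P) F (a ⊗ₜ b ⊗ₜ r) =
      a ⊗ₜ (F • b) ⊗ₜ r := fun F a b => by
    rw [← aeval_del]
    exact (map_aeval ((TensorProduct.mk k (P ⊗[k] P) P).flip r ∘ₗ TensorProduct.mk k P P a)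
      (del k P) (del₂ k P) (fun _ => rfl) F b).symm
  rw [toVPoly_tmul, map_aeval (ofVPoly a b) _ _ (ofVPoly_lam a b),
    map_aeval (ofVPoly a b) _ (-del₁ k P - del₃ k P)
      (fun w => by simp [ofVPoly_lam, ofVPoly_del]), ofVPoly_const, ← h₁, ← h₂, ← map_sub]
  obtain ⟨z, hz⟩ := aeval_sub_mem_range (pair d q) (a ⊗ₜ[k] b ⊗ₜ[k] r)
  rw [← hz]
  -- The factor in `∂₁` commutes with `∂₁ + ∂₂ + ∂₃`, so it can be moved onto the preimage `z`.
  refine ⟨Polynomial.aeval (del₁ k P) (pair c p) z, ?_⟩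
  refine (map_aeval (del₁ k P + del₂ k P + del₃ k P) _ _ (fun w => ?_) _ _)
  have hc : Commute (del₁ k P + del₂ k P + del₃ k P) (del₁ k P) :=
    ((Commute.refl _).add_left commute_del₁_del₂.symm).add_left commute_del₁_del₃.symm
  exact LinearMap.congr_fun hc.eq w

/-- If `P` has a finite dual family over `k[∂]`, then `w ∈ P ⊗ P ⊗ P` lies in the image of
`∂_1 + ∂_2 + ∂_3` as soon as triples of characters of total weight zero vanish on `w`. -/
theorem mem_range_of_triple [CharZero k] {ι : Type*} [Fintype ι] (e : ι → P) (c : ι → CDual k P)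
    (hec : ∀ p, ∑ i, pair (c i) p • e i = p) {w : P ⊗[k] P ⊗[k] P}
    (hw : ∀ i j l (s t u : k), s + t + u = 0 →
      triple (pairAt (c i) s) (pairAt (c j) t) (pairAt (c l) u) w = 0) :
    w ∈ LinearMap.range (del₁ k P + del₂ k P + del₃ k P) := by
  -- At each scalar `s` the value is expanded in the dual family; its coefficients are polynomials
  -- in `u`, and the hypothesis makes them vanish at every `u`.
  have hz : ∀ i j, toVPoly (c i) (c j) w = 0 := fun i j => vpoly_ext (k := k) fun s => by
    rw [map_zero, ← hec (ev s _)]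
    refine Finset.sum_eq_zero fun l _ => ?_
    rw [Polynomial.funext (p := pair (c l) _) (q := 0) fun u => ?_, zero_smul]
    rw [← pairAt_apply, pairAt_toVPoly, hw i j l s (-s - u) u (by ring), Polynomial.eval_zero]
  -- Modulo the image, every `w` is recovered from its polynomials, so `w` itself lies in the image
  -- when they all vanish.
  have H : ∀ w : P ⊗[k] P ⊗[k] P, w - ∑ i, ∑ j, ofVPoly (e i) (e j) (toVPoly (c i) (c j) w) ∈
      LinearMap.range (del₁ k P + del₂ k P + del₃ k P) := by
    intro w
    induction w using TensorProduct.induction_on with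
    | zero => simp
    | add x y hx hy =>
      simp only [map_add, Finset.sum_add_distrib, add_sub_add_comm]
      exact add_mem hx hy
    | tmul w r =>
      induction w using TensorProduct.induction_on with
      | zero => simp
      | add x y hx hy =>
        simp only [TensorProduct.add_tmul, map_add, Finset.sum_add_distrib, add_sub_add_comm]
        exact add_mem hx hy
      | tmul p q =>
        have hpq : p ⊗ₜ[k] q ⊗ₜ[k] r =
            ∑ i, ∑ j, (pair (c i) p • e i) ⊗ₜ[k] (pair (c j) q • e j) ⊗ₜ[k] r := by
          simp only [← TensorProduct.sum_tmul, ← TensorProduct.tmul_sum, hec]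
        rw [hpq]
        simp only [← Finset.sum_sub_distrib]
        -- The expansion has also been inserted into the arguments of `toVPoly`; there it is undone.
        rw [← hpq]
        exact sum_mem fun i _ => sum_mem fun j _ => ofVPoly_toVPoly _ _ _ _ _ _ _
  simpa [hz] using H w

end Characters

/-! ### Values of `[[r, r]]` at triples of characters. -/

section YangBaxterValues

variable {k : Type*} [Field k]
  {P : Type*} [AddCommGroup P] [Module k P] [Module k[X] P] [IsScalarTower k k[X] P]

/-- `a ⊗ b ↦ χ(a) b`. -/
def contractLeft (χ : P →ₗ[k] k) : P ⊗[k] P →ₗ[k] P :=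
  (TensorProduct.lid k P).toLinearMap ∘ₗ LinearMap.rTensor P χ

theorem functional_sum_pow (ψ : P ⊗[k] P ⊗[k] P →ₗ[k] k) (D : Module.End k (P ⊗[k] P ⊗[k] P))
    (s : k) (h : ∀ w, ψ (D w) = s • ψ w) (φ : P →ₗ[k] P ⊗[k] P ⊗[k] P) (p : VPoly P) :
    ψ (p.sum fun n x => (D ^ n) (φ x)) = ψ (φ (ev s p)) := by
  have : (p.sum fun n x => (D ^ n) (φ x)) = subst D φ p := rfl
  rw [this, map_subst ψ D (s • 1) (by simpa using h), subst_scalar]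
  rfl

/-- The values of `[[r, r]]` at triples of characters, for symmetric `r`. -/
theorem triple_yangBaxter (L : LeibnizConformalAlgebra k P) {χ₁ χ₂ χ₃ : P →ₗ[k] k} {s t u : k}
    (h₁ : ∀ p, χ₁ (del k P p) = s • χ₁ p) (h₂ : ∀ p, χ₂ (del k P p) = t • χ₂ p)
    (hu : s + t + u = 0) {r : P ⊗[k] P} (hr : tau r = r) :
    triple χ₁ χ₂ χ₃ (yangBaxter L r) =
      χ₁ (ev t (L.bracket (contractLeft χ₂ r) (contractLeft χ₃ r))) +
        χ₃ (ev t (L.bracket (contractLeft χ₂ r) (contractLeft χ₁ r))) -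
        χ₂ (ev s (L.bracket (contractLeft χ₁ r) (contractLeft χ₃ r))) -
        χ₂ (ev u (L.bracket (contractLeft χ₃ r) (contractLeft χ₁ r))) := by
  obtain ⟨n, a, b, hab⟩ := TensorProduct.exists_sum_tmul_eq r
  -- Symmetry of `r` allows contraction on either leg. Both forms are needed, because the brackets
  -- in `[[r, r]]` involve the `a i` as well as the `b i`.
  have hl : ∀ χ : P →ₗ[k] k, contractLeft χ r = ∑ i, χ (a i) • b i := fun χ => by
    rw [hab, map_sum]; rfl
  have hr' : ∀ χ : P →ₗ[k] k, contractLeft χ r = ∑ i, χ (b i) • a i := fun χ => by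
    rw [← hr, hab, map_sum, map_sum]; rfl
  -- Total weight zero turns `-∂₁ - ∂₂` into `-s - t = u`.
  have h₄ : ∀ w, triple χ₁ χ₂ χ₃ ((-del₁ k P - del₂ k P) w) = u • triple χ₁ χ₂ χ₃ w := fun w => by
    rw [LinearMap.sub_apply, LinearMap.neg_apply, map_sub, map_neg, triple_del₁ h₁,
      triple_del₂ h₂, ← neg_smul, ← sub_smul]
    congr 1
    linear_combination -hu
  have e₁ : ∀ i j, triple χ₁ χ₂ χ₃
      ((L.bracket (a i) (a j)).sum fun n x => (del₂ k P ^ n) (x ⊗ₜ[k] b i ⊗ₜ[k] b j)) =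
        χ₁ (ev t (L.bracket (a i) (a j))) * χ₂ (b i) * χ₃ (b j) := fun i j =>
    functional_sum_pow _ _ t (triple_del₂ h₂)
      ((TensorProduct.mk k (P ⊗[k] P) P).flip (b j) ∘ₗ (TensorProduct.mk k P P).flip (b i)) _
  have e₂ : ∀ i j, triple χ₁ χ₂ χ₃
      ((L.bracket (b j) (b i)).sum fun n x => (del₂ k P ^ n) (a i ⊗ₜ[k] a j ⊗ₜ[k] x)) =
        χ₁ (a i) * χ₂ (a j) * χ₃ (ev t (L.bracket (b j) (b i))) := fun i j =>
    functional_sum_pow _ _ t (triple_del₂ h₂) (TensorProduct.mk k (P ⊗[k] P) P (a i ⊗ₜ a j)) _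
  have e₃ : ∀ i j, triple χ₁ χ₂ χ₃
      ((L.bracket (b i) (a j)).sum fun n x => (del₁ k P ^ n) (a i ⊗ₜ[k] x ⊗ₜ[k] b j)) =
        χ₁ (a i) * χ₂ (ev s (L.bracket (b i) (a j))) * χ₃ (b j) := fun i j =>
    functional_sum_pow _ _ s (triple_del₁ h₁)
      ((TensorProduct.mk k (P ⊗[k] P) P).flip (b j) ∘ₗ TensorProduct.mk k P P (a i)) _
  have e₄ : ∀ i j, triple χ₁ χ₂ χ₃
      ((L.bracket (a j) (b i)).sum fun n x =>
        ((-del₁ k P - del₂ k P) ^ n) (a i ⊗ₜ[k] x ⊗ₜ[k] b j)) =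
        χ₁ (a i) * χ₂ (ev u (L.bracket (a j) (b i))) * χ₃ (b j) := fun i j =>
    functional_sum_pow _ _ u h₄
      ((TensorProduct.mk k (P ⊗[k] P) P).flip (b j) ∘ₗ TensorProduct.mk k P P (a i)) _
  have hb : ∀ (χ : P →ₗ[k] k) (z : k) (c d : Fin n → k) (x y : Fin n → P),
      χ (ev z (L.bracket (∑ i, c i • x i) (∑ j, d j • y j))) =
        ∑ i, ∑ j, c i * d j * χ (ev z (L.bracket (x i) (y j))) := fun χ z c d x y => by
    rw [Finset.sum_comm]
    simp only [map_sum, map_smul, LinearMap.sum_apply, LinearMap.smul_apply, smul_eq_mul,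
      Finset.mul_sum, mul_assoc, mul_left_comm (d _)]
  have f₁ : χ₁ (ev t (L.bracket (contractLeft χ₂ r) (contractLeft χ₃ r))) =
      ∑ i, ∑ j, χ₁ (ev t (L.bracket (a i) (a j))) * χ₂ (b i) * χ₃ (b j) := by
    rw [hr' χ₂, hr' χ₃, hb]
    exact Finset.sum_congr rfl fun i _ => Finset.sum_congr rfl fun j _ => by ring
  have f₂ : χ₃ (ev t (L.bracket (contractLeft χ₂ r) (contractLeft χ₁ r))) =
      ∑ i, ∑ j, χ₁ (a i) * χ₂ (a j) * χ₃ (ev t (L.bracket (b j) (b i))) := by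
    -- In `[b_j, b_i]` the left entry carries the index `j`, so the order of summation is exchanged.
    rw [hl χ₂, hl χ₁, hb, Finset.sum_comm]
    exact Finset.sum_congr rfl fun i _ => Finset.sum_congr rfl fun j _ => by ring
  have f₃ : χ₂ (ev s (L.bracket (contractLeft χ₁ r) (contractLeft χ₃ r))) =
      ∑ i, ∑ j, χ₁ (a i) * χ₂ (ev s (L.bracket (b i) (a j))) * χ₃ (b j) := by
    rw [hl χ₁, hr' χ₃, hb]
    exact Finset.sum_congr rfl fun i _ => Finset.sum_congr rfl fun j _ => by ring
  have f₄ : χ₂ (ev u (L.bracket (contractLeft χ₃ r) (contractLeft χ₁ r))) =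
      ∑ i, ∑ j, χ₁ (a i) * χ₂ (ev u (L.bracket (a j) (b i))) * χ₃ (b j) := by
    rw [hl χ₁, hr' χ₃, hb, Finset.sum_comm]
    exact Finset.sum_congr rfl fun i _ => Finset.sum_congr rfl fun j _ => by ring
  rw [f₁, f₂, f₃, f₄]
  conv_lhs => rw [hab, yangBaxter_sum]
  simp only [map_sum, map_sub, map_add, e₁, e₂, e₃, e₄, Finset.sum_add_distrib,
    Finset.sum_sub_distrib]

end YangBaxterValues

/-! ### Coordinates and characters of `M`, `M^{*c}` and `Q ⊕ M^{*c}`. -/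

section Duality

variable {k : Type*} [Field k]
  {Q : Type*} [AddCommGroup Q] [Module k Q] [Module k[X] Q] [IsScalarTower k k[X] Q]
  {M : Type*} [AddCommGroup M] [Module k M] [Module k[X] M] [IsScalarTower k k[X] M]

theorem pair_smul (f : CDual k M) (p : k[X]) (v : M) : pair f (p • v) = p * pair f v := by
  rw [← aeval_del, map_aeval (pair f) _ (del k k[X]) (pair_del f), aeval_del, smul_eq_mul]

/-- On the dual `∂` multiplies the pairing by `-λ`, so `p(∂)` multiplies it by `p(-λ)`. -/
theorem pair_smul_left (f : CDual k M) (p : k[X]) (v : M) :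
    pair (p • f) v = Polynomial.aeval (-Polynomial.X : k[X]) p * pair f v := by
  rw [← aeval_del, ← LinearMap.flip_apply, map_aeval (pair.flip v) _
    (LinearMap.mulLeft k (-Polynomial.X : k[X]))
    (fun w => by simp [pair_del_left]), LinearMap.flip_apply]
  have h := Polynomial.aeval_algHom_apply (Algebra.lmul k k[X]) (-Polynomial.X : k[X]) p
  exact LinearMap.congr_fun h (pair f v)

theorem sum_pair_dualBasis {ι : Type*} [Fintype ι] (b : Module.Basis ι k[X] M) (v : M) :
    ∑ i, pair (dualBasis b i) v • b i = v := b.sum_repr v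

/-- The sign change compensates the one in `pair_smul_left`, as `X ↦ -X` is an involution. Together
with `sum_pair_dualBasis` this supplies the finite dual family of `Q ⊕ M^{*c}`. -/
theorem sum_pair_smul_dualBasis {ι : Type*} [Fintype ι] (b : Module.Basis ι k[X] M)
    (f : CDual k M) :
    ∑ i, Polynomial.aeval (-Polynomial.X : k[X]) (pair f (b i)) • dualBasis b i = f := by
  have h : ∀ p : k[X], Polynomial.aeval (-Polynomial.X : k[X])
      (Polynomial.aeval (-Polynomial.X : k[X]) p) = p := fun p => by
    rw [← Polynomial.aeval_algHom_apply]
    simp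
  refine CDual.ext fun v => ?_
  conv_rhs => rw [← sum_pair_dualBasis b v]
  simp only [map_sum, LinearMap.sum_apply, pair_smul_left, pair_smul, h, mul_comm]

/-- Characters separate the points of a finite free module. -/
theorem eq_of_forall_pairAt_eq [CharZero k] [Module.Finite k[X] M] [Module.Free k[X] M] {v w : M}
    (h : ∀ (f : CDual k M) (u : k), pairAt f u v = pairAt f u w) : v = w := by
  let b := Module.Free.chooseBasis k[X] M
  rw [← sum_pair_dualBasis b v, ← sum_pair_dualBasis b w]
  exact Finset.sum_congr rfl fun i _ => congrArg (· • b i) (Polynomial.funext (h _))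

/-- The character `(q, f) ↦ ⟨φ, q⟩_λ + ⟨f, x⟩_{-λ}` of `Q ⊕ M^{*c}`. -/
def prodChar (φ : CDual k Q) (x : M) : CDual k (Q × CDual k M) :=
  CDual.mk (pair φ ∘ₗ LinearMap.fst k Q (CDual k M) +
    (Polynomial.aeval (-Polynomial.X : k[X])).toLinearMap ∘ₗ pair.flip x ∘ₗ
      LinearMap.snd k Q (CDual k M)) fun p => by
    -- Since `∂` multiplies `⟨f, x⟩_λ` by `-λ`, evaluating that pairing at `-λ` makes both summands
    -- scale by `λ`.
    simp [del_prod, pair_del, pair_del_left, mul_add]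

theorem pair_prodChar (φ : CDual k Q) (x : M) (p : Q × CDual k M) :
    pair (prodChar φ x) p =
      pair φ p.1 + Polynomial.aeval (-Polynomial.X : k[X]) (pair p.2 x) := rfl

theorem pairAt_prodChar (φ : CDual k Q) (x : M) (u : k) (p : Q × CDual k M) :
    pairAt (prodChar φ x) u p = pairAt φ u p.1 + pairAt p.2 (-u) x := by
  rw [pairAt_apply, pair_prodChar, Polynomial.eval_add, pairAt_apply, pairAt_apply,
    ← Polynomial.comp_eq_aeval, Polynomial.eval_comp]
  simp

/-- At `λ = 0` the map `φ(f ⊗ a)` sends `x` to `⟨f, x⟩_∂ a`, and a functional of weight `c` replaces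
this `∂` by `c`. -/
theorem atZero_phi_tmul (ψ : Q →ₗ[k] k) (c : k) (h : ∀ q, ψ (del k Q q) = c • ψ q)
    (f : CDual k M) (a : Q) (x : M) :
    ψ ((phi k M Q (f ⊗ₜ a)).atZero x) = pairAt f c x * ψ a := by
  have h' := functional_aeval (ψ ∘ₗ Finsupp.lapply 0) (lam k Q + del k (VPoly Q)) c
    (fun p => by simp [lam_zero, del_coeff, h]) (pair f x) (const k Q a)
  refine h'.trans ?_
  simp [const, pairAt_apply]

theorem atZero_add (S T : Chom k M Q) (x : M) : (S + T).atZero x = S.atZero x + T.atZero x := rfl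

/-! ### Contractions of `e + τ e`. -/

/-- `e + τ e` for `e ∈ M^{*c} ⊗ Q`. -/
def symTensor : CDual k M ⊗[k] Q →ₗ[k] (Q × CDual k M) ⊗[k] (Q × CDual k M) :=
  inclTensor k Q M + tau ∘ₗ inclTensor k Q M

theorem tau_symTensor (e : CDual k M ⊗[k] Q) : tau (symTensor e) = symTensor e := by
  have h : ∀ w : (Q × CDual k M) ⊗[k] (Q × CDual k M), tau (tau w) = w :=
    fun w => (TensorProduct.comm k _ _).symm_apply_apply w
  simp [symTensor, h, add_comm]

theorem contractLeft_symTensor_tmul (χ : (Q × CDual k M) →ₗ[k] k) (f : CDual k M) (a : Q) :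
    contractLeft χ (symTensor (f ⊗ₜ a)) = (χ (0, f) • a, χ (a, 0) • f) := by
  have : contractLeft χ (symTensor (f ⊗ₜ a)) =
      χ (0, f) • (a, (0 : CDual k M)) + χ (a, 0) • ((0 : Q), f) := by
    rw [symTensor, LinearMap.add_apply, map_add]; rfl
  simp [this]

/-- For `e = f ⊗ a` the `Q`-component is `⟨f, x⟩_{-u} a`, whereas `φ(e)_0 x = ⟨f, x⟩_∂ a`; a
functional of weight `-u` cannot tell them apart. The functional `φ` plays no role in this
component. -/
theorem contractLeft_symTensor_fst (φ : CDual k Q) (x : M) (u : k) (e : CDual k M ⊗[k] Q)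
    (ψ : Q →ₗ[k] k) (h : ∀ q, ψ (del k Q q) = -u • ψ q) :
    ψ (contractLeft (pairAt (prodChar φ x) u) (symTensor e)).1 =
      ψ ((phi k M Q e).atZero x) := by
  induction e using TensorProduct.induction_on with
  | zero => simp [show (0 : Chom k M Q).atZero x = 0 from rfl]
  | add e e' he he' => simp only [map_add, Prod.fst_add, he, he', atZero_add]
  | tmul f a =>
    rw [atZero_phi_tmul ψ _ h, contractLeft_symTensor_tmul, pairAt_prodChar]
    simp

/-- For `e = f ⊗ a` the `M^{*c}`-component is `⟨φ, a⟩_u f`: up to evaluation at `u`, contraction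
with `φ` is the transpose of `φ(e)_0`. The vector `x` plays no role here. -/
theorem contractLeft_symTensor_snd (φ : CDual k Q) (x v : M) (u : k) (e : CDual k M ⊗[k] Q) :
    pairAt (contractLeft (pairAt (prodChar φ x) u) (symTensor e)).2 u v =
      pairAt φ u ((phi k M Q e).atZero v) := by
  induction e using TensorProduct.induction_on with
  | zero => simp [show (0 : Chom k M Q).atZero v = 0 from rfl, pairAt_apply]
  | add e e' he he' => simp only [map_add, Prod.snd_add, pairAt_add, he, he', atZero_add]
  | tmul f a =>
    rw [atZero_phi_tmul (pairAt φ u) _ (pairAt_del φ u), contractLeft_symTensor_tmul]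
    have h : pairAt (prodChar φ x) u ((a, 0) : Q × CDual k M) = pairAt φ u a := by
      rw [pairAt_prodChar]
      simp [pairAt_apply]
    rw [h]
    simp [pairAt_apply, mul_comm]

end Duality

/-! ### The defect of the `𝒪`-operator identity and the CLCYBE. -/

section Defect

variable {k : Type*} [Field k] [CharZero k]
  {Q : Type*} [AddCommGroup Q] [Module k Q] [Module k[X] Q] [IsScalarTower k k[X] Q]
  {M : Type*} [AddCommGroup M] [Module k M] [Module k[X] M] [IsScalarTower k k[X] M]
  {L : LeibnizConformalAlgebra k Q}

/-- The value at the character `⟨φ, ·⟩_u` of the defect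
`[S(x)_s S(y)] - S(l(S(x))_s y + r(S(y))_{-s-∂} x)` of the `𝒪`-operator identity. -/
def defect (ρ : Representation L M) (S : M →ₗ[k[X]] Q) (x y : M) (s : k) (φ : CDual k Q)
    (u : k) : k :=
  pairAt φ u (ev s (L.bracket (S x) (S y))) - pairAt φ u (S (ev s (ρ.l (S x) y))) -
    pairAt φ u (S (ev (-s - u) (ρ.r (S y) x)))

theorem lin_del (S : M →ₗ[k[X]] Q) (v : M) : S (del k M v) = del k Q (S v) := map_smul S _ v

/-- Both sides of the identity are polynomials in `λ` with coefficients in a finite free module, so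
they may be compared at scalars and under characters. -/
theorem isOOperator_iff_defect [Module.Finite k[X] Q] [Module.Free k[X] Q]
    (ρ : Representation L M) (S : M →ₗ[k[X]] Q) :
    IsOOperator ρ S ↔ ∀ x y s φ u, defect ρ S x y s φ u = 0 := by
  have h : ∀ (x y : M) (s : k) (φ : CDual k Q) (u : k),
      pairAt φ u (ev s (Finsupp.mapRange.linearMap (S.restrictScalars k)
        (ρ.l (S x) y + skew k M (ρ.r (S y) x)))) =
      pairAt φ u (S (ev s (ρ.l (S x) y))) + pairAt φ u (S (ev (-s - u) (ρ.r (S y) x))) := by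
    intro x y s φ u
    rw [ev_mapRange, map_add, ev_skew, map_add, map_add]
    congr 1
    -- As `S` commutes with `∂`, the composite functional has weight `u`, and `-s - ∂` becomes `-s -
    -- u`.
    exact map_evS (pairAt φ u ∘ₗ S.restrictScalars k) u s
      (fun w => by simp [lin_del, pairAt_del]) _
  constructor
  · intro H x y s φ u
    rw [defect, H x y, h]
    ring
  · intro H x y
    refine vpoly_ext (k := k) fun s => eq_of_forall_pairAt_eq (k := k) fun φ u => ?_
    rw [h]
    have := H x y s φ u
    rw [defect] at this
    linear_combination this

variable [Module.Finite k[X] M]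

/-- The third character reads the `Q`-part of the bracket through `φ₃` and the `M^{*c}`-part through
`x₃`. The weights sum to zero exactly so that each slot of the bracket has the weight at which a
contraction can be replaced by a value of `φ(e)_0`. -/
theorem pairAt_bracket_contractLeft (ρ : Representation L M) (e : CDual k M ⊗[k] Q)
    (φ₁ φ₂ φ₃ : CDual k Q) (x₁ x₂ x₃ : M) {u₁ u₂ u₃ : k} (hu : u₁ + u₂ + u₃ = 0) :
    pairAt (prodChar φ₃ x₃) u₃ (ev u₁ (ρ.dual.semidirect.bracket
        (contractLeft (pairAt (prodChar φ₁ x₁) u₁) (symTensor e))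
        (contractLeft (pairAt (prodChar φ₂ x₂) u₂) (symTensor e)))) =
      pairAt φ₃ u₃ (ev u₁ (L.bracket ((phi k M Q e).atZero x₁) ((phi k M Q e).atZero x₂))) -
        pairAt φ₂ u₂ ((phi k M Q e).atZero (ev u₁ (ρ.l ((phi k M Q e).atZero x₁) x₃))) +
        pairAt φ₁ u₁ ((phi k M Q e).atZero (ev u₂ (ρ.l ((phi k M Q e).atZero x₂) x₃))) +
        pairAt φ₁ u₁ ((phi k M Q e).atZero (ev u₂ (ρ.r ((phi k M Q e).atZero x₂) x₃))) := by
  have hfst := fun φ x u ψ h => contractLeft_symTensor_fst (M := M) φ x u e ψ h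
  have hsnd := fun φ x v u => contractLeft_symTensor_snd (M := M) φ x v u e
  -- From here on, `S` enters only as a `k[∂]`-linear map with the two contraction properties.
  generalize (phi k M Q e).atZero = S at hfst hsnd ⊢
  set R₁ := contractLeft (pairAt (prodChar φ₁ x₁) u₁) (symTensor e) with hR₁
  set R₂ := contractLeft (pairAt (prodChar φ₂ x₂) u₂) (symTensor e) with hR₂
  have e₁ : ev u₁ (ρ.dual.semidirect.bracket R₁ R₂) = (ev u₁ (L.bracket R₁.1 R₂.1),
      ev u₁ (dualCend k M (ρ.l R₁.1) R₂.2) + evS u₁ (ρ.dualRight R₂.1 R₁.2)) :=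
    ρ.dual.ev_semidirectBracket u₁ R₁ R₂
  -- An action evaluated at `s` has weight `-s` in its algebra argument, so a contraction at weight
  -- `s` there acts as `S x`.
  have act : ∀ (l : Q →ₗ[k[X]] Chom k M M) (φ φ' : CDual k Q) (x v : M) (s u : k),
      pairAt φ u (S (ev s (l (contractLeft (pairAt (prodChar φ' x) s) (symTensor e)).1 v))) =
        pairAt φ u (S (ev s (l (S x) v))) := fun l φ φ' x v s u =>
    hfst φ' x s (pairAt φ u ∘ₗ S.restrictScalars k ∘ₗ ev s ∘ₗ Chom.toLin.flip v ∘ₗ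
      l.restrictScalars k) fun q => by
        simp [lin_map_del, Chom.del_apply, ev_lam]
  have br : pairAt φ₃ u₃ (ev u₁ (L.bracket R₁.1 R₂.1)) =
      pairAt φ₃ u₃ (ev u₁ (L.bracket (S x₁) (S x₂))) := by
    -- The left slot has weight `-u₁` and the right slot weight `u₁ + u₃ = -u₂`, so the two
    -- contractions can be replaced one after the other.
    have h₁ := hfst φ₁ x₁ u₁ (pairAt φ₃ u₃ ∘ₗ ev u₁ ∘ₗ L.bracket.flip R₂.1)
      fun q => by simp [L.del_left, ev_lam]
    have h₂ := hfst φ₂ x₂ u₂ (pairAt φ₃ u₃ ∘ₗ ev u₁ ∘ₗ L.bracket (S x₁)) fun q => by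
      simp only [LinearMap.comp_apply, L.del_right, LinearMap.add_apply, map_add, ev_lam, ev_del,
        map_smul, pairAt_del, ← add_smul]
      congr 1
      linear_combination hu
    exact h₁.trans h₂
  -- The dual part is paired at `-u₃`. The left action at `u₁` shifts this to `u₂`; for the right
  -- action, `-u₁ - ∂` takes the value `u₂`, and the shift leads to `u₁`. These are the parameters
  -- required by `hsnd`.
  rw [e₁, pairAt_prodChar, br, pairAt_add, pairAt_dual, pairAt_evS, ρ.pairAt_dualRight,
    show -u₃ - u₁ = u₂ by linear_combination -hu, show -u₃ - u₂ = u₁ by linear_combination -hu,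
    hR₁, hR₂, hsnd, hsnd, hsnd, act, act, act]
  ring

/-- The values of `[[r, r]]` for `r = e + τ e` in terms of the defect of `φ(e)_0`. -/
theorem triple_yangBaxter_symTensor (ρ : Representation L M) (e : CDual k M ⊗[k] Q)
    (φ₁ φ₂ φ₃ : CDual k Q) (x₁ x₂ x₃ : M) {s t u : k} (hu : s + t + u = 0) :
    triple (pairAt (prodChar φ₁ x₁) s) (pairAt (prodChar φ₂ x₂) t) (pairAt (prodChar φ₃ x₃) u)
        (yangBaxter ρ.dual.semidirect (symTensor e)) =
      defect ρ (phi k M Q e).atZero x₂ x₃ t φ₁ s + defect ρ (phi k M Q e).atZero x₂ x₁ t φ₃ u -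
        defect ρ (phi k M Q e).atZero x₁ x₃ s φ₂ t -
        defect ρ (phi k M Q e).atZero x₃ x₁ u φ₂ t := by
  rw [triple_yangBaxter _ (pairAt_del _ _) (pairAt_del _ _) hu (tau_symTensor e),
    pairAt_bracket_contractLeft ρ e φ₂ φ₃ φ₁ x₂ x₃ x₁ (by linear_combination hu),
    pairAt_bracket_contractLeft ρ e φ₂ φ₁ φ₃ x₂ x₁ x₃ (by linear_combination hu),
    pairAt_bracket_contractLeft ρ e φ₁ φ₃ φ₂ x₁ x₃ x₂ (by linear_combination hu),
    pairAt_bracket_contractLeft ρ e φ₃ φ₁ φ₂ x₃ x₁ x₂ (by linear_combination hu)]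
  simp only [defect]
  rw [show -t - s = u by linear_combination -hu, show -t - u = s by linear_combination -hu,
    show -s - t = u by linear_combination -hu, show -u - t = s by linear_combination -hu]
  -- The four brackets contribute sixteen terms; the `l`-terms `⟨φ₁, S(l(S x₃) x₂)⟩` and `⟨φ₃, S(l(S
  -- x₁) x₂)⟩` each occur twice with opposite signs, and the other twelve form the four defects.
  ring

theorem isCLCYBESolution_symTensor_iff [Module.Free k[X] M] [Module.Finite k[X] Q]
    [Module.Free k[X] Q] (ρ : Representation L M) (e : CDual k M ⊗[k] Q) :
    IsCLCYBESolution ρ.dual.semidirect (symTensor e) ↔ IsOOperator ρ (phi k M Q e).atZero := by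
  rw [isOOperator_iff_defect]
  constructor
  · intro h x y t φ u
    -- With `φ₁ = φ₂ = 0` only the defect paired with `φ₃ = φ` survives. It has arguments `x₂ = x`,
    -- `x₁ = y` and free parameters `t`, `u`, while `s` absorbs the weight condition.
    have h' := triple_yangBaxter_symTensor ρ e 0 0 φ y x 0 (s := -t - u) (t := t) (u := u)
      (by ring)
    rw [triple_eq_zero_of_mem_range (pairAt_del _ _) (pairAt_del _ _) (pairAt_del _ _)
      (by ring) h] at h'
    have h0 : ∀ x y s u, defect ρ (phi k M Q e).atZero x y s 0 u = 0 := by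
      simp [defect, pairAt_apply]
    rw [h0, h0, h0] at h'
    linear_combination -h'
  · intro h
    let b := Module.Free.chooseBasis k[X] Q
    let b' := Module.Free.chooseBasis k[X] M
    -- A basis of `Q` together with the dual basis of `M^{*c}` spans `Q ⊕ M^{*c}`. The coordinate
    -- functionals are all of the form `prodChar`: the elements `b' j` of `M` serve as coordinates
    -- on `M^{*c}`.
    refine mem_range_of_triple
      (Sum.elim (fun i => (b i, 0)) fun j => (0, dualBasis b' j))
      (Sum.elim (fun i => prodChar (dualBasis b i) 0) fun j => prodChar 0 (b' j))
      (fun p => ?_) fun i j l s t u hu => ?_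
    · rw [Fintype.sum_sum_type]
      simp only [Sum.elim_inl, Sum.elim_inr, pair_prodChar, map_zero, LinearMap.zero_apply,
        zero_add, add_zero, Prod.smul_mk, smul_zero]
      ext1
      · simp [Prod.fst_sum, sum_pair_dualBasis]
      · simp [Prod.snd_sum, sum_pair_smul_dualBasis]
    · have hc : ∀ i, ∃ φ x, Sum.elim (fun i => prodChar (dualBasis b i) (0 : M))
          (fun j => prodChar 0 (b' j)) i = prodChar φ x := by
        rintro (i | j)
        exacts [⟨_, _, rfl⟩, ⟨_, _, rfl⟩]
      obtain ⟨φ₁, x₁, h₁⟩ := hc i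
      obtain ⟨φ₂, x₂, h₂⟩ := hc j
      obtain ⟨φ₃, x₃, h₃⟩ := hc l
      rw [h₁, h₂, h₃, triple_yangBaxter_symTensor ρ e _ _ _ _ _ _ hu]
      simp [h]

end Defect

end

end LeibnizConformal

/-! ### The theorem, by taking `e = η(T)`. -/

theorem theorem4p11 {k : Type*} [Field k] [CharZero k]
    {Q : Type*} [AddCommGroup Q] [Module k Q] [Module k[X] Q] [IsScalarTower k k[X] Q]
    [Module.Finite k[X] Q] [Module.Free k[X] Q]
    {M : Type*} [AddCommGroup M] [Module k M] [Module k[X] M] [IsScalarTower k k[X] M]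
    [Module.Finite k[X] M] [Module.Free k[X] M]
    (L : LeibnizConformal.LeibnizConformalAlgebra k Q)
    (ρ : LeibnizConformal.Representation L M) (T : LeibnizConformal.Chom k M Q) :
    LeibnizConformal.IsSymmetricSolution ρ.dual.semidirect
        (LeibnizConformal.inclTensor k Q M (LeibnizConformal.eta k M Q T) +
          LeibnizConformal.tau (LeibnizConformal.inclTensor k Q M (LeibnizConformal.eta k M Q T))) ↔
      LeibnizConformal.IsOOperator ρ T.atZero := by
  have h := LeibnizConformal.isCLCYBESolution_symTensor_iff ρ (LeibnizConformal.eta k M Q T)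
  have hT : LeibnizConformal.phi k M Q (LeibnizConformal.eta k M Q T) = T :=
    (LinearEquiv.ofBijective _ (LeibnizConformal.phi_bijective k M Q)).apply_symm_apply T
  rw [hT] at h
  rw [← h]
  -- Symmetry of `η(T) + τ η(T)` is automatic, so only the Yang–Baxter condition carries content.
  exact and_iff_right (LeibnizConformal.tau_symTensor _)
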